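/- **Setting.** Let $\mathcal C$ be a strict $(2,1)$-category (a strict 2-category all of whose 2-cells are invertible) with a chosen 2-terminal object. A *(split) display map 2-category* structure on $\mathcal C$ is a class $\mathcal D$ of 1-cells $P_A:\Gamma.A\to\Gamma$, called *display maps* (we write $A$ for $P_A$), such that: 1. for every display map $P_A:\Gamma.A\to\Gamma$ and every $f:\Delta\to\Gamma$ there are a chosen display map $P_{A[f]}:\Delta.A[f]\to\Delta$ and a 1-cell $f^\bullet:\Delta.A[f]\to\Gamma.A$ forming a square over $f$ which is a pullback for 1-cells and for 2-cells; moreover $A[1_\Gamma]=A$, $1_\Gamma^\bullet=1_{\Gamma.A}$, $A[fg]=A[f][g]$, $(fg)^\bullet=f^\bullet g^\bullet$. Iterating, one writes $f^{\bullet\bullet}$, $f^{\bullet\bullet\bullet}$ for the 1-cells over $f^\bullet$, $f^{\bullet\bullet}$. Write $A^\blacktriangledown=A[P_A]$. By the pullback property 1-cells and 2-cells over $\Gamma$ with codomain a display map over $\Gamma$ (in particular sections and vertical 2-cells between them) are re-indexed along $f$, which is denoted $(-)[f]$; for $u:f\to P_A$ over $\Gamma$, $1;u$ is the section of $P_{A[f]}$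 with $f^\bullet(1;u)=u$ (similarly for 2-cells), so that $a[f]=1;(af)$; 2. every display map is a cloven isofibration: for every 2-cell $p:f\Rightarrow P_Ag$ there are a chosen 1-cell $\mathsf t_g^p$ and a chosen 2-cell $\tau_g^p:\mathsf t_g^p\Rightarrow g$ with $P_A\mathsf t_g^p=f$ and $P_A*\tau_g^p=p$, and $\mathsf t_{gh}^{p*h}=\mathsf t_g^ph$, $\tau_{gh}^{p*h}=\tau_g^p*h$ for all composable 1-cells $h$; 3. these choices are compatible with re-indexing: let $\Gamma.A_1.\cdots.A_n\to\cdots\to\Gamma.A_1\to\Gamma$ ($n\ge1$) be display maps, with composite $P_{\mathbf A}:\Gamma.\mathbf A\to\Gamma$, let $P_C$ be a display map with codomain $\Gamma.\mathbf A$, let $f:\Delta\to\Gamma$, and let $f.\mathbf A:\Delta.\mathbf A[f]\to\Gamma.\mathbf A$ be the iterated $f^{\bullet\cdots\bullet}$. If $f':\Omega'\to\Omega$, $g:\Omega\to\Gamma.\mathbf A.C$, $h:\Omega\to\Gamma.\mathbf A$, $g':\Omega'\to\Delta.\mathbf A[f].C[f.\mathbf A]$, $h':\Omega'\to\Delta.\mathbf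 A[f]$ satisfy $(f.\mathbf A)^\bullet g'=gf'$ and $(f.\mathbf A)h'=hf'$, and if $p:h\Rightarrow P_Cg$ and $p':h'\Rightarrow P_{C[f.\mathbf A]}g'$ are 2-cells with $P_{\mathbf A}*p=1$, $P_{\mathbf A[f]}*p'=1$, $(f.\mathbf A)*p'=p*f'$, then $(f.\mathbf A)^\bullet\,\mathsf t_{g'}^{p'}=\mathsf t_g^pf'$ and $(f.\mathbf A)^\bullet*\tau_{g'}^{p'}=\tau_g^p*f'$. *Axiomatic $=$-types*: for every display map $P_A:\Gamma.A\to\Gamma$, a chosen display map $P_{\mathsf{Id}_A}:\Gamma.A.A^\blacktriangledown.\mathsf{Id}_A\to\Gamma.A.A^\blacktriangledown$ and a 2-cell $\alpha_A:\mathsf s\Rightarrow\mathsf t$ of $\mathcal C/\Gamma$, where $\mathsf s=P_{A^\blacktriangledown}P_{\mathsf{Id}_A}$ and $\mathsf t=P_A^\bullet P_{\mathsf{Id}_A}$, such that $\alpha_A$ is an arrow object of $P_A$ in $\mathcal C/\Gamma$ (for every $h:\Theta\to\Gamma$, composition with $\alpha_A$ is an isomorphism of categories from $(\mathcal C/\Gamma)(h,P_AP_{A^\blacktriangledown}P_{\mathsf{Id}_A})$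 to the arrow category of $(\mathcal C/\Gamma)(h,P_A)$), and $\mathsf{Id}_A[f^{\bullet\bullet}]=\mathsf{Id}_{A[f]}$, $\alpha_A[f]=\alpha_{A[f]}$ for every $f:\Delta\to\Gamma$. *Axiomatic $\Pi$-types and axiomatic function extensionality*: for every display maps $P_A:\Gamma.A\to\Gamma$ and $P_B:\Gamma.A.B\to\Gamma.A$, a chosen display map $\Gamma.\Pi_A^B\to\Gamma$ with $\Pi_A^B[f]=\Pi_{A[f]}^{B[f^\bullet]}$ for all $f:\Delta\to\Gamma$, and, for all $f:\Delta\to\Gamma$, functors $\lambda_A^B:(\mathcal C/\Gamma.A)(f^\bullet,P_B)\rightleftarrows(\mathcal C/\Gamma)(f,P_{\Pi_A^B}):\mathsf{app}_A^B$ with natural isomorphisms $\beta^{A,B}:\mathsf{app}_A^B\lambda_A^B\Rightarrow1$ and $\eta^{A,B}:1\Rightarrow\lambda_A^B\mathsf{app}_A^B$, such that $\lambda$ and $\mathsf{app}$ commute (as functors) with precomposition by $g^\bullet$ and $g$, for every $g:\Delta'\to\Delta$, and with the functors $1;(-)$ from data over $f$ to data over $1_\Delta$ for $A[f]$ and $B[f^\bullet]$,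 and $\beta_h^{A,B}g^\bullet=\beta^{A,B}_{hg^\bullet}$, $\eta_k^{A,B}g=\eta^{A,B}_{kg}$, $1;\beta_h^{A,B}=\beta^{A[f],B[f^\bullet]}_{1;h}$, $1;\eta_k^{A,B}=\eta_{1;k}^{A[f],B[f^\bullet]}$. **Derived notions.** For sections $a,b$ of $P_A$, $a;b:\Gamma\to\Gamma.A.A^\blacktriangledown$ is the 1-cell with $P_{A^\blacktriangledown}(a;b)=a$, $P_A^\bullet(a;b)=b$. For a vertical 2-cell $\sigma:a\Rightarrow b$, $\{\sigma\}$ is the section of $P_{\mathsf{Id}_A[a;b]}$ induced by the unique 1-cell $x$ over $\Gamma$ with $\alpha_A*x=\sigma$. The 1-cell $\mathsf r_A:\Gamma.A\to\Gamma.A.A^\blacktriangledown.\mathsf{Id}_A$ is the unique one over $\Gamma$ with $\alpha_A*\mathsf r_A=1_{1_{\Gamma.A}}$, and $\varphi_A:1\Rightarrow\mathsf r_A\mathsf t$ is the unique 2-cell over $\Gamma$ with $\mathsf s*\varphi_A=\alpha_A$ and $\mathsf t*\varphi_A=1_{\mathsf t}$. For a display map $P_C$ with codomain $\Gamma.A.A^\blacktriangledown.\mathsf{Id}_A$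 and a section $c$ of $P_{C[\mathsf r_A]}$, $\mathsf J_c=\mathsf t_{\mathsf r_A^\bullet c\mathsf t}^{\varphi_A}$, a section of $P_C$. For $P_A$ over $\Gamma$ and $P_B$ over $\Gamma.A$, $\mathsf{ev}=1;\mathsf{app}_A^B(1_{\Gamma.\Pi_A^B})$, a section of $P_{B[P_{\Pi_A^B}^\bullet]}$. From now on $\mathsf s,\mathsf t$ are those of $\mathsf{Id}_{\Pi_A^B}$. Let $P_{T_A^B}$ be the display map $$\Gamma.\Pi_A^B.(\Pi_A^B)^\blacktriangledown.\mathsf{Id}_{\Pi_A^B}.\Bigl(\Pi_{A[P_{\Pi_A^B}\mathsf s]}^{\mathsf{Id}_{B[(P_{\Pi_A^B}\mathsf s)^\bullet]}[\mathsf{ev}[\mathsf s^\bullet];\mathsf{ev}[\mathsf t^\bullet]]}\Bigr)\longrightarrow\Gamma.\Pi_A^B.(\Pi_A^B)^\blacktriangledown.\mathsf{Id}_{\Pi_A^B}.$$ One has $T_A^B[\mathsf r_{\Pi_A^B}]=\Pi_{A[P_{\Pi_A^B}]}^{\mathsf{Id}_{B[P_{\Pi_A^B}^\bullet]}[\mathsf{ev};\mathsf{ev}]}$,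 and $\mathsf{happly}_A^B=\mathsf J_c$ with $c=\lambda(\mathsf r_{B[P_{\Pi_A^B}^\bullet]}[\mathsf{ev}])$, where $\mathsf r_{B[P_{\Pi_A^B}^\bullet]}[\mathsf{ev}]$ is the section of $P_{\mathsf{Id}_{B[P_{\Pi_A^B}^\bullet]}[\mathsf{ev};\mathsf{ev}]}$ which $(\mathsf{ev};\mathsf{ev})^\bullet$ takes to $\mathsf r_{B[P_{\Pi_A^B}^\bullet]}\,\mathsf{ev}$. Let $\tilde\alpha:\tilde{\mathsf s}\Rightarrow\tilde{\mathsf t}$ be $1;\alpha_{\Pi_A^B}$, a 2-cell between sections of $P_{\Pi_A^B[P_{\Pi_A^B}\mathsf s]}$ (note that $\alpha_{\Pi_A^B}$ is a 2-cell over $\Gamma$ with domain $P_{\Pi_A^B}\mathsf s$). One has $\mathsf{app}\,\tilde{\mathsf s}=\mathsf{ev}[\mathsf s^\bullet]$ and $\mathsf{app}\,\tilde{\mathsf t}=\mathsf{ev}[\mathsf t^\bullet]$; let $\mathsf{happ}_A^B=\{\mathsf{app}\,\tilde\alpha\}$, so that $\lambda\,\mathsf{happ}_A^B$ is, like $\mathsf{happly}_A^B$,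 a section of $P_{T_A^B}$. **Theorem (the happy theorem).** Let $(\mathcal C,\mathcal D)$ be a display map 2-category endowed with axiomatic $=$-types and with axiomatic $\Pi$-types and axiomatic function extensionality. Then there is a family of arrows $$\theta_A^B:\mathsf{happly}_A^B\Longrightarrow\lambda\,\mathsf{happ}_A^B$$ in the category of sections of $P_{T_A^B}$, one for every object $\Gamma$ and all display maps $P_A:\Gamma.A\to\Gamma$ and $P_B:\Gamma.A.B\to\Gamma.A$, which is stable under re-indexing: for every $f:\Delta\to\Gamma$ one has $T_A^B[f^{\bullet\bullet\bullet}]=T_{A[f]}^{B[f^\bullet]}$ and $$\theta_A^B[f^{\bullet\bullet\bullet}]=\theta_{A[f]}^{B[f^\bullet]}$$ as 2-cells between sections of $P_{T_{A[f]}^{B[f^\bullet]}}$ (in particular their sources agree, and their targets agree), where $f^{\bullet\bullet\bullet}:\Delta.\Pi'.\Pi'^\blacktriangledown.\mathsf{Id}_{\Pi'}\to\Gamma.\Pi_A^B.(\Pi_A^B)^\blacktriangledown.\mathsf{Id}_{\Pi_A^B}$ with $\Pi'=\Pi_A^B[f]=\Pi_{A[f]}^{B[f^\bullet]}$. -/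

import Mathlib

open CategoryTheory Bicategory

universe w v u

namespace DisplayMap

section Slice

variable {C : Type u} [Bicategory.{w, v} C] [Bicategory.Strict C]

/-- A 1-cell `h ⟶ p` of the strict slice 2-category `C / Γ`. -/
@[ext]
structure SliceHom {X Y Γ : C} (h : X ⟶ Γ) (p : Y ⟶ Γ) where
  map : X ⟶ Y
  w : map ≫ p = h

namespace SliceHom

variable {X X' Y E Γ : C} {h : X ⟶ Γ} {p : Y ⟶ Γ}

/-- A 2-cell of the strict slice 2-category `C / Γ`: a 2-cell of `C` lying over an identity. -/
@[ext]
structure Hom (a b : SliceHom h p) where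
  cell : a.map ⟶ b.map
  vertical : cell ▷ p = eqToHom (a.w.trans b.w.symm)

/-- The hom-category `(C / Γ)(h, p)`. -/
instance : Category (SliceHom h p) where
  Hom := Hom
  id a := ⟨𝟙 a.map, by simp⟩
  comp σ τ := ⟨σ.cell ≫ τ.cell, by simp [σ.vertical, τ.vertical]⟩

@[ext]
theorem hom_ext {a b : SliceHom h p} (σ τ : a ⟶ b) (e : σ.cell = τ.cell) : σ = τ :=
  Hom.ext e

@[simp] theorem id_cell (a : SliceHom h p) : Hom.cell (𝟙 a) = 𝟙 a.map := rfl
@[simp] theorem comp_cell {a b c : SliceHom h p} (σ : a ⟶ b) (τ : b ⟶ c) :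
    (σ ≫ τ).cell = σ.cell ≫ τ.cell := rfl

@[simp] theorem eqToHom_cell {a b : SliceHom h p} (e : a = b) :
    Hom.cell (eqToHom e) = eqToHom (congrArg SliceHom.map e) := by
  subst e; rfl

/-- Precomposition by a 1-cell `g : h' ⟶ h` of `C / Γ`. -/
def precomp (g : X' ⟶ X) {h' : X' ⟶ Γ} (e : g ≫ h = h') :
    SliceHom h p ⥤ SliceHom h' p where
  obj a := ⟨g ≫ a.map, by rw [Category.assoc, a.w, e]⟩
  map {a b} σ := ⟨g ◁ σ.cell, by
    have := σ.vertical
    simp [whisker_assoc, this, Strict.associator_eqToIso]⟩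
  map_id a := by ext; simp
  map_comp σ τ := by ext; simp

theorem vertical_whiskerRight {e : E ⟶ Γ} {a b : SliceHom h e} (γ : a ⟶ b)
    (s : SliceHom e p) :
    (γ.cell ▷ s.map) ▷ p = eqToHom (by rw [Category.assoc, Category.assoc, s.w, a.w, b.w]) := by
  obtain ⟨s, rfl⟩ := s
  have h1 := γ.vertical
  rw [← cancel_epi (α_ a.map s p).inv, ← cancel_mono (α_ b.map s p).hom]
  rw [Category.assoc, ← whiskerRight_comp, h1]
  simp [Strict.associator_eqToIso]

/-- Post-composition with a 2-cell `α : s ⟶ t` of `C / Γ` -/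
def arrowComparison {e : E ⟶ Γ} {s t : SliceHom e p} (α : s ⟶ t) (h : X ⟶ Γ) :
    SliceHom h e ⥤ Arrow (SliceHom h p) where
  obj a := Arrow.mk ((precomp a.map a.w).map α)
  map {a b} γ := Arrow.homMk
    (⟨γ.cell ▷ s.map, vertical_whiskerRight γ s⟩ :
      (precomp a.map a.w).obj s ⟶ (precomp b.map b.w).obj s)
    (⟨γ.cell ▷ t.map, vertical_whiskerRight γ t⟩ :
      (precomp a.map a.w).obj t ⟶ (precomp b.map b.w).obj t)
    (by ext; exact (whisker_exchange γ.cell α.cell).symm)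
  map_id a := by ext <;> simp [precomp]
  map_comp σ τ := by ext <;> simp [precomp]

/-- `α : s ⟶ t` is an arrow object of `p` (in `C / Γ`): the comparison functors
`(C / Γ)(h, e) ⥤ (C / Γ)(h, p)^→` are isomorphisms of categories, for all `h`. -/
def IsArrowObject {e : E ⟶ Γ} {s t : SliceHom e p} (α : s ⟶ t) : Prop :=
  ∀ {X : C} (h : X ⟶ Γ), Function.Bijective (arrowComparison α h).obj ∧
    (arrowComparison α h).Full ∧ (arrowComparison α h).Faithful

end SliceHom

/-- The display maps of codomain `Γ`: the 1-cells of the class `D` with target `Γ`. -/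
@[ext]
structure Disp (D : MorphismProperty C) (Γ : C) where
  obj : C
  p : obj ⟶ Γ
  mem : D p

/-- A class of 1-cells with a chosen 2-terminal object and a split choice of
1- and 2-dimensional pullbacks. -/
structure SplitDisplay (C : Type u) [Bicategory.{w, v} C] [Bicategory.Strict C] where
  pt : C
  pt_unique : ∀ X : C, Nonempty (Unique (X ⟶ pt))
  pt_unique₂ : ∀ {X : C} (f g : X ⟶ pt), Nonempty (Unique (f ⟶ g))
  D : MorphismProperty C
  /-- `A[f]` -/
  re : ∀ {Γ Ξ : C}, Disp D Γ → (Ξ ⟶ Γ) → Disp D Ξ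
  /-- `f.A`, also written `f•` -/
  up : ∀ {Γ Ξ : C} (f : Ξ ⟶ Γ) (A : Disp D Γ), (re A f).obj ⟶ A.obj
  isPullback : ∀ {Γ Ξ : C} (f : Ξ ⟶ Γ) (A : Disp D Γ), IsPullback (up f A) (re A f).p A.p f
  isPullback₂ : ∀ {Γ Ξ : C} (f : Ξ ⟶ Γ) (A : Disp D Γ) {Ω : C} {x y : Ω ⟶ (re A f).obj}
    (a : x ≫ up f A ⟶ y ≫ up f A) (b : x ≫ (re A f).p ⟶ y ≫ (re A f).p),
    Arrow.mk (a ▷ A.p) = Arrow.mk (b ▷ f) →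
    ∃! c : x ⟶ y, c ▷ up f A = a ∧ c ▷ (re A f).p = b
  re_id : ∀ {Γ : C} (A : Disp D Γ), re A (𝟙 Γ) = A
  up_id : ∀ {Γ : C} (A : Disp D Γ), up (𝟙 Γ) A = eqToHom (congrArg Disp.obj (re_id A))
  re_comp : ∀ {Γ Ξ Θ : C} (g : Θ ⟶ Ξ) (f : Ξ ⟶ Γ) (A : Disp D Γ), re A (g ≫ f) = re (re A f) g
  up_comp : ∀ {Γ Ξ Θ : C} (g : Θ ⟶ Ξ) (f : Ξ ⟶ Γ) (A : Disp D Γ),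
    up (g ≫ f) A = eqToHom (congrArg Disp.obj (re_comp g f A)) ≫ up g (re A f) ≫ up f A

namespace SplitDisplay

/-- Telescopes `A₁, …, Aₙ` (with `n ≥ 0`) of display maps
`Γ.A₁ ⟶ Γ`, `Γ.A₁.A₂ ⟶ Γ.A₁`, …, of base `Γ`. -/
inductive Tele (S : SplitDisplay C) : C → Type (max u v) where
  | nil (Γ : C) : Tele S Γ
  | cons {Γ : C} (A : Disp S.D Γ) (T : Tele S A.obj) : Tele S Γ

namespace Tele

variable {S : SplitDisplay C}

/-- The object `Γ.A₁.….Aₙ`. -/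
def obj : {Γ : C} → Tele S Γ → C
  | _, nil Γ => Γ
  | _, cons _ T => T.obj

/-- The composite of display maps `Γ.A₁.….Aₙ ⟶ Γ`. -/
def p : {Γ : C} → (T : Tele S Γ) → (T.obj ⟶ Γ)
  | _, nil Γ => 𝟙 Γ
  | _, cons A T => T.p ≫ A.p

/-- The telescope `A₁[f], A₂[f•], A₃[f••], …`. -/
def re : {Γ Ξ : C} → Tele S Γ → (Ξ ⟶ Γ) → Tele S Ξ
  | _, Ξ, nil _, _ => nil Ξ
  | _, _, cons A T, f => cons (S.re A f) (T.re (S.up f A))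

/-- The 1-cell `f•⋯• : Ξ.A₁[f].⋯ ⟶ Γ.A₁.⋯`. -/
def up : {Γ Ξ : C} → (T : Tele S Γ) → (f : Ξ ⟶ Γ) → ((T.re f).obj ⟶ T.obj)
  | _, _, nil _, f => f
  | _, _, cons A T, f => T.up (S.up f A)

end Tele

end SplitDisplay

/-- A split display map 2-category: split choices of pullbacks of display maps, which are moreover
cloven isofibrations, compatibly with re-indexing. -/
structure DisplayMap2Category (C : Type u) [Bicategory.{w, v} C] [Bicategory.Strict C]
    [IsLocallyGroupoid C] extends SplitDisplay C where
  /-- The chosen 1-cell lifting `p`. -/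
  t : ∀ {Γ Ξ : C} (A : Disp D Γ) {f : Ξ ⟶ Γ} (g : Ξ ⟶ A.obj), (f ⟶ g ≫ A.p) → (Ξ ⟶ A.obj)
  /-- The chosen 2-cell lifting `p`. -/
  τ : ∀ {Γ Ξ : C} (A : Disp D Γ) {f : Ξ ⟶ Γ} (g : Ξ ⟶ A.obj) (p : f ⟶ g ≫ A.p), t A g p ⟶ g
  t_p : ∀ {Γ Ξ : C} (A : Disp D Γ) {f : Ξ ⟶ Γ} (g : Ξ ⟶ A.obj) (p : f ⟶ g ≫ A.p),
    t A g p ≫ A.p = f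
  τ_p : ∀ {Γ Ξ : C} (A : Disp D Γ) {f : Ξ ⟶ Γ} (g : Ξ ⟶ A.obj) (p : f ⟶ g ≫ A.p),
    τ A g p ▷ A.p = eqToHom (t_p A g p) ≫ p
  t_comp : ∀ {Γ Ξ Ω : C} (A : Disp D Γ) {f : Ξ ⟶ Γ} (g : Ξ ⟶ A.obj) (p : f ⟶ g ≫ A.p)
    (h : Ω ⟶ Ξ), t A (h ≫ g) (h ◁ p ≫ (α_ h g A.p).inv) = h ≫ t A g p
  τ_comp : ∀ {Γ Ξ Ω : C} (A : Disp D Γ) {f : Ξ ⟶ Γ} (g : Ξ ⟶ A.obj) (p : f ⟶ g ≫ A.p)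
    (h : Ω ⟶ Ξ), Arrow.mk (τ A (h ≫ g) (h ◁ p ≫ (α_ h g A.p).inv)) = Arrow.mk (h ◁ τ A g p)
  /-- Compatibility of the chosen lifts with re-indexing along `f`, for a display map `P_Q` over a
  nonempty telescope `T` of base `Γ`. The 2-cell `p'` is the re-indexing `p[f]` of `p`. -/
  cleavage_stable : ∀ {Γ Ξ : C} (f : Ξ ⟶ Γ) (T : SplitDisplay.Tele toSplitDisplay Γ)
    (Q : Disp D T.obj) {Ω Ω' : C} (f' : Ω' ⟶ Ω)
    (g : Ω ⟶ Q.obj) (h : Ω ⟶ T.obj) (g' : Ω' ⟶ (re Q (T.up f)).obj) (h' : Ω' ⟶ (T.re f).obj)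
    (p : h ⟶ g ≫ Q.p) (p' : h' ⟶ g' ≫ (re Q (T.up f)).p),
    T ≠ SplitDisplay.Tele.nil Γ →
    g' ≫ up (T.up f) Q = f' ≫ g →
    h' ≫ T.up f = f' ≫ h →
    Arrow.mk (p ▷ T.p) = Arrow.mk (𝟙 (h ≫ T.p)) →
    Arrow.mk (p' ▷ (T.re f).p) = Arrow.mk (𝟙 (h' ≫ (T.re f).p)) →
    Arrow.mk (p' ▷ T.up f) = Arrow.mk (f' ◁ p) →
    t (re Q (T.up f)) g' p' ≫ up (T.up f) Q = f' ≫ t Q g p ∧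
    Arrow.mk (τ (re Q (T.up f)) g' p' ▷ up (T.up f) Q) = Arrow.mk (f' ◁ τ Q g p)

namespace SplitDisplay

variable (S : SplitDisplay C)

/-- `A▼ = A[P_A]`. -/
abbrev wk {Γ : C} (A : Disp S.D Γ) : Disp S.D A.obj := S.re A A.p

/-- Sections of `P_A`, with the vertical 2-cells between them: the category `(C / Γ)(1, P_A)`. -/
abbrev Sec {Γ : C} (A : Disp S.D Γ) := SliceHom (𝟙 Γ) A.p

variable {S}

theorem up_p {Γ Ξ : C} (f : Ξ ⟶ Γ) (A : Disp S.D Γ) :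
    S.up f A ≫ A.p = (S.re A f).p ≫ f := (S.isPullback f A).w

/-- The 1-cell into `Ξ.A[f]` induced by `g : Ω ⟶ Γ.A` and `h : Ω ⟶ Ξ`. -/
noncomputable def lift {Γ Ξ Ω : C} {f : Ξ ⟶ Γ} {A : Disp S.D Γ} (g : Ω ⟶ A.obj) (h : Ω ⟶ Ξ)
    (w : g ≫ A.p = h ≫ f) : Ω ⟶ (S.re A f).obj :=
  (S.isPullback f A).lift g h w

@[simp] theorem lift_up {Γ Ξ Ω : C} {f : Ξ ⟶ Γ} {A : Disp S.D Γ} (g : Ω ⟶ A.obj) (h : Ω ⟶ Ξ)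
    (w : g ≫ A.p = h ≫ f) : lift g h w ≫ S.up f A = g :=
  (S.isPullback f A).lift_fst g h w

@[simp] theorem lift_p {Γ Ξ Ω : C} {f : Ξ ⟶ Γ} {A : Disp S.D Γ} (g : Ω ⟶ A.obj) (h : Ω ⟶ Ξ)
    (w : g ≫ A.p = h ≫ f) : lift g h w ≫ (S.re A f).p = h :=
  (S.isPullback f A).lift_snd g h w

theorem hom_ext {Γ Ξ Ω : C} {f : Ξ ⟶ Γ} {A : Disp S.D Γ} {x y : Ω ⟶ (S.re A f).obj}
    (h₁ : x ≫ S.up f A = y ≫ S.up f A) (h₂ : x ≫ (S.re A f).p = y ≫ (S.re A f).p) : x = y :=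
  (S.isPullback f A).hom_ext h₁ h₂

theorem arrow_mk_whiskerRight_whiskerRight {X Y Z W : C} {x y : X ⟶ Y} (c : x ⟶ y) (f : Y ⟶ Z)
    (g : Z ⟶ W) : Arrow.mk ((c ▷ f) ▷ g) = Arrow.mk (c ▷ (f ≫ g)) := by
  rw [Arrow.mk_eq_mk_iff]
  exact ⟨Category.assoc _ _ _, Category.assoc _ _ _, by
    simp [whiskerRight_comp, Strict.associator_eqToIso]⟩

theorem arrow_mk_conj {T : Type*} [Category T] {a b a' b' : T} (f : a ⟶ b) (h : a' = a)
    (k : b = b') : Arrow.mk (eqToHom h ≫ f ≫ eqToHom k) = Arrow.mk f := by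
  subst h; subst k; simp

theorem arrow_mk_eqToHom_comp {T : Type*} [Category T] {a b c : T} (h : a = b)
    (k : b = c) : Arrow.mk (eqToHom h ≫ eqToHom k) = Arrow.mk (𝟙 b) := by
  subst h; subst k; simp

theorem arrow_mk_whiskerRight_congr {X Y Z : C} {x y : X ⟶ Y} (c : x ⟶ y) {f g : Y ⟶ Z}
    (e : f = g) : Arrow.mk (c ▷ f) = Arrow.mk (c ▷ g) := by
  rw [e]

theorem cell_ext {Γ Ξ Ω : C} {f : Ξ ⟶ Γ} {A : Disp S.D Γ} {x y : Ω ⟶ (S.re A f).obj}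
    (c d : x ⟶ y) (h₁ : c ▷ S.up f A = d ▷ S.up f A)
    (h₂ : c ▷ (S.re A f).p = d ▷ (S.re A f).p) : c = d :=
  (S.isPullback₂ f A (d ▷ S.up f A) (d ▷ (S.re A f).p) (by
    rw [arrow_mk_whiskerRight_whiskerRight, arrow_mk_whiskerRight_whiskerRight]
    exact arrow_mk_whiskerRight_congr d (up_p f A))).unique ⟨h₁, h₂⟩ ⟨rfl, rfl⟩

/-- `1;u`: the section of `P_{A[f]}` induced by a 1-cell `u : f ⟶ P_A` of `C / Γ`. -/
noncomputable def secOf {Γ Ξ : C} {f : Ξ ⟶ Γ} {A : Disp S.D Γ} (u : SliceHom f A.p) :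
    S.Sec (S.re A f) :=
  ⟨lift u.map (𝟙 Ξ) (by rw [u.w, Category.id_comp]), lift_p _ _ _⟩

@[simp] theorem secOf_up {Γ Ξ : C} {f : Ξ ⟶ Γ} {A : Disp S.D Γ} (u : SliceHom f A.p) :
    (secOf u).map ≫ S.up f A = u.map := lift_up _ _ _

theorem secOf_map_exists {Γ Ξ : C} {f : Ξ ⟶ Γ} {A : Disp S.D Γ} {u v : SliceHom f A.p}
    (σ : u ⟶ v) : ∃ c : secOf u ⟶ secOf v,
      c.cell ▷ S.up f A = eqToHom (secOf_up u) ≫ σ.cell ≫ eqToHom (secOf_up v).symm := by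
  obtain ⟨c, ⟨h₁, h₂⟩, -⟩ := S.isPullback₂ f A (x := (secOf u).map) (y := (secOf v).map)
    (eqToHom (secOf_up u) ≫ σ.cell ≫ eqToHom (secOf_up v).symm)
    (eqToHom ((secOf u).w.trans (secOf v).w.symm)) (by
      have := σ.vertical
      rw [comp_whiskerRight, comp_whiskerRight, this, Arrow.mk_eq_mk_iff]
      exact ⟨by rw [Category.assoc, up_p, Category.assoc],
        by rw [Category.assoc, up_p, Category.assoc], by simp⟩)
  exact ⟨⟨c, h₂⟩, h₁⟩

variable (S) in
/-- The functor `1;_` from `(C / Γ)(f, P_A)` to the sections of `P_{A[f]}`. On a 2-cell `σ`, it is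
the unique vertical 2-cell that `f•` takes to `σ`. -/
noncomputable def sec {Γ Ξ : C} (f : Ξ ⟶ Γ) (A : Disp S.D Γ) :
    SliceHom f A.p ⥤ S.Sec (S.re A f) where
  obj u := secOf u
  map σ := (secOf_map_exists σ).choose
  map_id u := by
    ext
    refine cell_ext _ _ ?_ ?_
    · rw [(secOf_map_exists (𝟙 u)).choose_spec]; simp
    · rw [(secOf_map_exists (𝟙 u)).choose.vertical]; simp
  map_comp σ τ := by
    ext
    refine cell_ext _ _ ?_ ?_
    · rw [(secOf_map_exists (σ ≫ τ)).choose_spec]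
      simp [(secOf_map_exists σ).choose_spec, (secOf_map_exists τ).choose_spec]
    · rw [(secOf_map_exists (σ ≫ τ)).choose.vertical]
      simp [SliceHom.Hom.vertical]

theorem sec_map_up {Γ Ξ : C} {f : Ξ ⟶ Γ} {A : Disp S.D Γ} {u v : SliceHom f A.p}
    (σ : u ⟶ v) : ((S.sec f A).map σ).cell ▷ S.up f A =
      eqToHom (secOf_up u) ≫ σ.cell ≫ eqToHom (secOf_up v).symm :=
  (secOf_map_exists σ).choose_spec

variable (S) in
/-- Re-indexing of sections and of their 2-cells: `a ↦ a[f]`. -/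
noncomputable def secRe {Γ Ξ : C} (f : Ξ ⟶ Γ) (A : Disp S.D Γ) : S.Sec A ⥤ S.Sec (S.re A f) :=
  SliceHom.precomp f (Category.comp_id f) ⋙ S.sec f A

/-- The identification of the categories of sections of equal display maps. -/
def castSec {Γ : C} {A A' : Disp S.D Γ} (e : A = A') : S.Sec A ⥤ S.Sec A' := e ▸ 𝟭 (S.Sec A)

/-- `a;b : Γ ⟶ Γ.A.A▼`. -/
noncomputable def pair {Γ : C} {A : Disp S.D Γ} (a b : S.Sec A) : Γ ⟶ (S.wk A).obj :=
  lift b.map a.map (by rw [a.w, b.w])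

/-- For a 1-cell `g : f' ⟶ f` of `C / Γ`, the 1-cell `g• : Θ.A[f'] ⟶ Ξ.A[f]`,
where `A[f'] = A[f][g]`. -/
def bump {Γ Ξ Θ : C} (A : Disp S.D Γ) {f : Ξ ⟶ Γ} {f' : Θ ⟶ Γ} (g : Θ ⟶ Ξ) (e : g ≫ f = f') :
    (S.re A f').obj ⟶ (S.re A f).obj :=
  eqToHom (congrArg Disp.obj (by rw [← e, S.re_comp])) ≫ S.up g (S.re A f)

theorem bump_up {Γ Ξ Θ : C} (A : Disp S.D Γ) {f : Ξ ⟶ Γ} {f' : Θ ⟶ Γ} (g : Θ ⟶ Ξ)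
    (e : g ≫ f = f') : bump A g e ≫ S.up f A = S.up f' A := by
  subst e
  rw [S.up_comp, bump, Category.assoc]

theorem eqToHom_p {Γ : C} {A A' : Disp S.D Γ} (e : A = A') :
    eqToHom (congrArg Disp.obj e) ≫ A'.p = A.p := by
  subst e; simp

theorem bump_p {Γ Ξ Θ : C} (A : Disp S.D Γ) {f : Ξ ⟶ Γ} {f' : Θ ⟶ Γ} (g : Θ ⟶ Ξ)
    (e : g ≫ f = f') : bump A g e ≫ (S.re A f).p = (S.re A f').p ≫ g := by
  subst e
  rw [bump, Category.assoc, up_p, ← Category.assoc, eqToHom_p (S.re_comp g f A)]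

theorem wk_re {Γ Ξ : C} (f : Ξ ⟶ Γ) (A : Disp S.D Γ) :
    S.wk (S.re A f) = S.re (S.wk A) (S.up f A) := by
  rw [wk, wk, ← S.re_comp, ← S.re_comp, up_p]

variable (S) in
/-- `f•• : Ξ.A[f].A[f]▼ ⟶ Γ.A.A▼`, where `A[f]▼ = A▼[f•]`. -/
def up₂ {Γ Ξ : C} (f : Ξ ⟶ Γ) (A : Disp S.D Γ) : (S.wk (S.re A f)).obj ⟶ (S.wk A).obj :=
  eqToHom (congrArg Disp.obj (wk_re f A)) ≫ S.up (S.up f A) (S.wk A)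

/-- The source `P_{A▼} P_J` of an identity type `J` on `A`, over `Γ`. -/
def src {Γ : C} {A : Disp S.D Γ} (J : Disp S.D (S.wk A).obj) :
    SliceHom (J.p ≫ (S.wk A).p ≫ A.p) A.p :=
  ⟨J.p ≫ (S.wk A).p, Category.assoc _ _ _⟩

/-- The target `P_A• P_J` of an identity type `J` on `A`, over `Γ`. -/
def tgt {Γ : C} {A : Disp S.D Γ} (J : Disp S.D (S.wk A).obj) :
    SliceHom (J.p ≫ (S.wk A).p ≫ A.p) A.p :=
  ⟨J.p ≫ S.up A.p A, by rw [Category.assoc, up_p]⟩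

end SplitDisplay

namespace SplitDisplay

variable (S : SplitDisplay C)

/-- The identification of `(C / Γ.A)(1, P_B)` with `(C / Γ.A)(1_Γ•, P_B)`, where `1_Γ• = 1`. -/
def toOne {Γ : C} (A : Disp S.D Γ) (B : Disp S.D A.obj) :
    S.Sec B ⥤ SliceHom (S.up (𝟙 Γ) A) B.p :=
  SliceHom.precomp (S.up (𝟙 Γ) A) (Category.comp_id _)

/-- The identification of `(C / Γ.A)(1_Γ•, P_B)` with `(C / Γ.A)(1, P_B)`, where `1_Γ• = 1`. -/
def ofOne {Γ : C} (A : Disp S.D Γ) (B : Disp S.D A.obj) :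
    SliceHom (S.up (𝟙 Γ) A) B.p ⥤ S.Sec B :=
  SliceHom.precomp (eqToHom (congrArg Disp.obj (S.re_id A).symm)) (by simp [S.up_id])

variable {S}

theorem sec_ext {Γ Ξ : C} {f : Ξ ⟶ Γ} {A : Disp S.D Γ} {a b : S.Sec (S.re A f)}
    (h : a.map ≫ S.up f A = b.map ≫ S.up f A) : a = b :=
  SliceHom.ext (SplitDisplay.hom_ext h (a.w.trans b.w.symm))

theorem castSec_map {Γ : C} {A A' : Disp S.D Γ} (e : A = A') (a : S.Sec A) :
    ((castSec e).obj a).map = a.map ≫ eqToHom (congrArg Disp.obj e) := by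
  subst e; exact (Category.comp_id _).symm

theorem sec_obj_up {Γ Ξ : C} (f : Ξ ⟶ Γ) (A : Disp S.D Γ) (a : SliceHom f A.p) :
    ((S.sec f A).obj a).map ≫ S.up f A = a.map := secOf_up a

theorem secRe_obj_up {Γ Ξ : C} (f : Ξ ⟶ Γ) (A : Disp S.D Γ) (a : S.Sec A) :
    ((S.secRe f A).obj a).map ≫ S.up f A = f ≫ a.map := secOf_up _

theorem ofOne_toOne {Γ : C} (A : Disp S.D Γ) (B : Disp S.D A.obj) (a : S.Sec B) :
    (S.ofOne A B).obj ((S.toOne A B).obj a) = a := by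
  refine SliceHom.ext ?_
  simp [ofOne, toOne, SliceHom.precomp, S.up_id]

theorem eqToHom_up {Γ Ξ : C} {f f' : Ξ ⟶ Γ} (A : Disp S.D Γ) (e : f' = f) :
    eqToHom (congrArg Disp.obj (congrArg (S.re A) e)) ≫ S.up f A = S.up f' A := by
  subst e; simp

theorem pair_up {Γ : C} {A : Disp S.D Γ} (a b : S.Sec A) : pair a b ≫ S.up A.p A = b.map :=
  lift_up _ _ _

theorem pair_p {Γ : C} {A : Disp S.D Γ} (a b : S.Sec A) : pair a b ≫ (S.wk A).p = a.map :=
  lift_p _ _ _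

theorem up₂_p {Γ Ξ : C} (f : Ξ ⟶ Γ) (A : Disp S.D Γ) :
    S.up₂ f A ≫ (S.wk A).p = (S.wk (S.re A f)).p ≫ S.up f A := by
  rw [up₂, Category.assoc, up_p, ← Category.assoc, eqToHom_p (wk_re f A)]

theorem up₂_up {Γ Ξ : C} (f : Ξ ⟶ Γ) (A : Disp S.D Γ) :
    S.up₂ f A ≫ S.up A.p A = S.up (S.re A f).p (S.re A f) ≫ S.up f A := by
  have h₁ := S.up_comp (S.up f A) A.p A
  have h₂ := S.up_comp (S.re A f).p f A
  have h₃ := eqToHom_up A (up_p f A)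
  rw [h₁, h₂] at h₃
  rw [up₂, Category.assoc, ← cancel_epi (eqToHom (congrArg Disp.obj
    (S.re_comp (S.re A f).p f A))), ← cancel_epi (eqToHom (congrArg Disp.obj (congrArg (S.re A)
    (up_p f A)))), h₃]
  simp

/-- The square relating `a;b` and `a[f];b[f]`. -/
theorem pair_up₂ {Γ Ξ : C} (f : Ξ ⟶ Γ) (A : Disp S.D Γ) (a b : S.Sec A) :
    pair ((S.secRe f A).obj a) ((S.secRe f A).obj b) ≫ S.up₂ f A = f ≫ pair a b := by
  refine SplitDisplay.hom_ext ?_ ?_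
  · rw [Category.assoc, up₂_up, ← Category.assoc, pair_up, secRe_obj_up, Category.assoc, pair_up]
  · rw [Category.assoc, up₂_p, ← Category.assoc, pair_p, secRe_obj_up, Category.assoc, pair_p]

/-- `a[u]` as a section of `P_{B[v']}`, where `v' = v u`. -/
theorem castSec_secRe_up {Γ Ξ Θ : C} {B : Disp S.D Γ} {v : Ξ ⟶ Γ} {u : Θ ⟶ Ξ} {v' : Θ ⟶ Γ}
    (e : u ≫ v = v') (eD : S.re (S.re B v) u = S.re B v') (a : S.Sec (S.re B v)) :
    ((castSec eD).obj ((S.secRe u (S.re B v)).obj a)).map ≫ S.up v' B =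
      u ≫ a.map ≫ S.up v B := by
  subst e
  rw [castSec_map, S.up_comp, ← Category.assoc u, ← secRe_obj_up]
  simp

theorem bump_comp {Γ Ξ Θ Λ : C} (A : Disp S.D Γ) {f : Ξ ⟶ Γ} {f' : Θ ⟶ Γ} {f'' : Λ ⟶ Γ}
    (k : Λ ⟶ Θ) (g : Θ ⟶ Ξ) (e : g ≫ f = f') (e' : k ≫ f' = f'') (e'' : (k ≫ g) ≫ f = f'') :
    bump A (k ≫ g) e'' = bump A k e' ≫ bump A g e := by
  refine SplitDisplay.hom_ext ?_ ?_
  · rw [Category.assoc, bump_up, bump_up, bump_up]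
  · rw [Category.assoc, bump_p, bump_p, ← Category.assoc (bump A k e'), bump_p, Category.assoc]

end SplitDisplay

open SplitDisplay

variable [IsLocallyGroupoid C]

/-- Axiomatic `=`-types. -/
structure AxiomaticId (S : DisplayMap2Category C) where
  /-- The display map `Γ.A.A▼.Id_A ⟶ Γ.A.A▼`. -/
  Id : ∀ {Γ : C} (A : Disp S.D Γ), Disp S.D (S.wk A).obj
  /-- The 2-cell `α_A : P_{A▼} P_{Id_A} ⟶ P_A• P_{Id_A}` of `C / Γ`. -/
  α : ∀ {Γ : C} (A : Disp S.D Γ), src (Id A) ⟶ tgt (Id A)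
  isArrowObject : ∀ {Γ : C} (A : Disp S.D Γ), SliceHom.IsArrowObject (α A)
  Id_re : ∀ {Γ Ξ : C} (f : Ξ ⟶ Γ) (A : Disp S.D Γ), S.re (Id A) (S.up₂ f A) = Id (S.re A f)
  /-- `α_A[f] = α_{A[f]}`: the vertical 2-cell `α_{A[f]}` is taken by `f•` to the restriction of
  `α_A` along `f•••`. -/
  α_re : ∀ {Γ Ξ : C} (f : Ξ ⟶ Γ) (A : Disp S.D Γ),
    Arrow.mk ((α (S.re A f)).cell ▷ S.up f A) =
      Arrow.mk ((eqToHom (congrArg Disp.obj (Id_re f A).symm) ≫ S.up (S.up₂ f A) (Id A)) ◁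
        (α A).cell)

namespace AxiomaticId

variable {S : DisplayMap2Category C} (I : AxiomaticId S)

/-- The composite display map `Γ.A.A▼.Id_A ⟶ Γ`. -/
abbrev base {Γ : C} (A : Disp S.D Γ) : (I.Id A).obj ⟶ Γ := (I.Id A).p ≫ (S.wk A).p ≫ A.p

/-- `s_A = P_{A▼} P_{Id_A}`, as a 1-cell over `Γ`. -/
abbrev s {Γ : C} (A : Disp S.D Γ) : SliceHom (I.base A) A.p := src (I.Id A)

/-- `t_A = P_A• P_{Id_A}`, as a 1-cell over `Γ`. -/
abbrev t {Γ : C} (A : Disp S.D Γ) : SliceHom (I.base A) A.p := tgt (I.Id A)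

/-- `f••• : Ξ.A'.A'▼.Id_{A'} ⟶ Γ.A.A▼.Id_A`, where `A' = A[f]`. -/
def up₃ {Γ Ξ : C} (f : Ξ ⟶ Γ) {A : Disp S.D Γ} {A' : Disp S.D Ξ} (e : A' = S.re A f) :
    (I.Id A').obj ⟶ (I.Id A).obj :=
  eqToHom (by rw [e, I.Id_re f A]) ≫ S.up (S.up₂ f A) (I.Id A)

/-- The unique 1-cell `p` over `Γ` whose composite with `α_A` is `σ`. -/
noncomputable def tilde {Γ X : C} {A : Disp S.D Γ} {h : X ⟶ Γ} {a b : SliceHom h A.p}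
    (σ : a ⟶ b) : SliceHom h (I.base A) :=
  ((I.isArrowObject A h).1.surjective (Arrow.mk σ)).choose

section

variable {Γ X : C} {A : Disp S.D Γ} {h : X ⟶ Γ} {a b : SliceHom h A.p} (σ : a ⟶ b)

theorem tilde_spec : (SliceHom.arrowComparison (I.α A) h).obj (I.tilde σ) = Arrow.mk σ :=
  ((I.isArrowObject A h).1.surjective (Arrow.mk σ)).choose_spec

theorem tilde_src : (I.tilde σ).map ≫ (I.s A).map = a.map :=
  congrArg (fun x : Arrow (SliceHom h A.p) => x.left.map) (I.tilde_spec σ)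

theorem tilde_tgt : (I.tilde σ).map ≫ (I.t A).map = b.map :=
  congrArg (fun x : Arrow (SliceHom h A.p) => x.right.map) (I.tilde_spec σ)

theorem tilde_cell : Arrow.mk ((I.tilde σ).map ◁ (I.α A).cell) = Arrow.mk σ.cell :=
  congrArg (fun x : Arrow (SliceHom h A.p) => Arrow.mk x.hom.cell) (I.tilde_spec σ)

end

/-- `{σ}`: the section of `P_{Id_A[a;b]}` induced by a 2-cell `σ : a ⟶ b` of sections of `P_A`. -/
noncomputable def curly {Γ : C} {A : Disp S.D Γ} {a b : S.Sec A} (σ : a ⟶ b) :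
    S.Sec (S.re (I.Id A) (pair a b)) :=
  (S.sec (pair a b) (I.Id A)).obj ⟨(I.tilde σ).map, by
    refine SplitDisplay.hom_ext ?_ ?_
    · rw [Category.assoc, pair, lift_up]; exact I.tilde_tgt σ
    · rw [Category.assoc, pair, lift_p]; exact I.tilde_src σ⟩

/-- `r_A`: the 1-cell whose composite with `α_A` is the identity 2-cell. -/
noncomputable def r {Γ : C} (A : Disp S.D Γ) : SliceHom A.p (I.base A) :=
  I.tilde (𝟙 (⟨𝟙 A.obj, Category.id_comp _⟩ : SliceHom A.p A.p))

theorem r_src {Γ : C} (A : Disp S.D Γ) : (I.r A).map ≫ (I.s A).map = 𝟙 A.obj := I.tilde_src _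

theorem r_tgt {Γ : C} (A : Disp S.D Γ) : (I.r A).map ≫ (I.t A).map = 𝟙 A.obj := I.tilde_tgt _

theorem r_cell {Γ : C} (A : Disp S.D Γ) :
    Arrow.mk ((I.r A).map ◁ (I.α A).cell) = Arrow.mk (𝟙 (𝟙 A.obj)) := I.tilde_cell _

theorem φ_exists {Γ : C} (A : Disp S.D Γ) :
    ∃ φ : 𝟙 (I.Id A).obj ⟶ (I.t A).map ≫ (I.r A).map,
      Arrow.mk (φ ▷ (I.s A).map) = Arrow.mk (I.α A).cell ∧
      Arrow.mk (φ ▷ (I.t A).map) = Arrow.mk (𝟙 (I.t A).map) := by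
  have e₁ := I.r_src A
  have e₂ := I.r_tgt A
  let U : SliceHom (I.base A) (I.base A) := ⟨𝟙 _, Category.id_comp _⟩
  let V : SliceHom (I.base A) (I.base A) :=
    ⟨(I.t A).map ≫ (I.r A).map, by rw [Category.assoc, (I.r A).w, (I.t A).w]⟩
  have es : (SliceHom.precomp U.map U.w).obj (I.s A) = I.s A :=
    SliceHom.ext (Category.id_comp _)
  have et : (SliceHom.precomp U.map U.w).obj (I.t A) = I.t A :=
    SliceHom.ext (Category.id_comp _)
  have es' : (SliceHom.precomp V.map V.w).obj (I.s A) = I.t A :=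
    SliceHom.ext (show ((I.t A).map ≫ (I.r A).map) ≫ (I.s A).map = _ by
      rw [Category.assoc, e₁, Category.comp_id])
  have et' : (SliceHom.precomp V.map V.w).obj (I.t A) = I.t A :=
    SliceHom.ext (show ((I.t A).map ≫ (I.r A).map) ≫ (I.t A).map = _ by
      rw [Category.assoc, e₂, Category.comp_id])
  have sq : (eqToHom es ≫ I.α A ≫ eqToHom es'.symm) ≫ (SliceHom.precomp V.map V.w).map (I.α A) =
      (SliceHom.precomp U.map U.w).map (I.α A) ≫ eqToHom et ≫ eqToHom et'.symm := by
    obtain ⟨h₁, h₂, h₃⟩ := (Arrow.mk_eq_mk_iff _ _).1 (I.r_cell A)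
    ext
    simp only [SliceHom.comp_cell, SliceHom.eqToHom_cell]
    simp [SliceHom.precomp, comp_whiskerLeft, h₃, U, V,
      Strict.associator_eqToIso, Strict.leftUnitor_eqToIso]
    erw [eqToHom_trans, eqToHom_trans, eqToHom_trans]
  have := (I.isArrowObject A (I.base A)).2.1
  obtain ⟨φ, hφ⟩ := Functor.map_surjective
    (SliceHom.arrowComparison (I.α A) (I.base A)) (X := U) (Y := V)
    (Arrow.homMk (eqToHom es ≫ I.α A ≫ eqToHom es'.symm) (eqToHom et ≫ eqToHom et'.symm) sq)
  refine ⟨φ.cell, ?_, ?_⟩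
  · have h : φ.cell ▷ (I.s A).map = (eqToHom es ≫ I.α A ≫ eqToHom es'.symm).cell :=
      congrArg (fun x => x.left.cell) hφ
    rw [h]
    simp only [SliceHom.comp_cell, SliceHom.eqToHom_cell]
    exact arrow_mk_conj _ _ _
  · have h : φ.cell ▷ (I.t A).map = (eqToHom et ≫ eqToHom et'.symm).cell :=
      congrArg (fun x => x.right.cell) hφ
    rw [h]
    simp only [SliceHom.comp_cell, SliceHom.eqToHom_cell]
    exact arrow_mk_eqToHom_comp _ _

/-- `φ_A : 1 ⟶ r_A (P_A• P_{Id_A})`: the unique 2-cell over `Γ` whose restrictions to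
the source and to the target are `α_A` and the identity. -/
noncomputable def φ {Γ : C} (A : Disp S.D Γ) :
    𝟙 (I.Id A).obj ⟶ (I.t A).map ≫ (I.r A).map := (I.φ_exists A).choose

/-- The elimination term `J_c`: the lift of `φ_A` to the pseudo-term `r_A• c (P_A• P_{Id_A})`. -/
noncomputable def J {Γ : C} {A : Disp S.D Γ} (Q : Disp S.D (I.Id A).obj)
    (c : S.Sec (S.re Q (I.r A).map)) : S.Sec Q :=
  ⟨S.t Q ((I.t A).map ≫ c.map ≫ S.up (I.r A).map Q) (I.φ A ≫ eqToHom (by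
      rw [Category.assoc, Category.assoc, up_p, ← Category.assoc c.map, c.w, Category.id_comp])),
    S.t_p Q _ _⟩

end AxiomaticId

/-- Axiomatic `Π`-types and axiomatic function extensionality. -/
structure AxiomaticPi (S : DisplayMap2Category C) where
  /-- The display map `Γ.Π_A^B ⟶ Γ`. -/
  Pi : ∀ {Γ : C} (A : Disp S.D Γ), Disp S.D A.obj → Disp S.D Γ
  Pi_re : ∀ {Γ Ξ : C} (f : Ξ ⟶ Γ) (A : Disp S.D Γ) (B : Disp S.D A.obj),
    S.re (Pi A B) f = Pi (S.re A f) (S.re B (S.up f A))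
  lam : ∀ {Γ Ξ : C} (A : Disp S.D Γ) (B : Disp S.D A.obj) (f : Ξ ⟶ Γ),
    SliceHom (S.up f A) B.p ⥤ SliceHom f (Pi A B).p
  app : ∀ {Γ Ξ : C} (A : Disp S.D Γ) (B : Disp S.D A.obj) (f : Ξ ⟶ Γ),
    SliceHom f (Pi A B).p ⥤ SliceHom (S.up f A) B.p
  β : ∀ {Γ Ξ : C} (A : Disp S.D Γ) (B : Disp S.D A.obj) (f : Ξ ⟶ Γ),
    lam A B f ⋙ app A B f ≅ 𝟭 (SliceHom (S.up f A) B.p)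
  η : ∀ {Γ Ξ : C} (A : Disp S.D Γ) (B : Disp S.D A.obj) (f : Ξ ⟶ Γ),
    𝟭 (SliceHom f (Pi A B).p) ≅ app A B f ⋙ lam A B f
  /-- Naturality along `g : f' ⟶ f` in `C / Γ`. -/
  lam_precomp : ∀ {Γ Ξ Θ : C} (A : Disp S.D Γ) (B : Disp S.D A.obj) {f : Ξ ⟶ Γ} {f' : Θ ⟶ Γ}
    (g : Θ ⟶ Ξ) (e : g ≫ f = f'),
    lam A B f ⋙ SliceHom.precomp g e =
      SliceHom.precomp (bump A g e) (bump_up A g e) ⋙ lam A B f'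
  app_precomp : ∀ {Γ Ξ Θ : C} (A : Disp S.D Γ) (B : Disp S.D A.obj) {f : Ξ ⟶ Γ} {f' : Θ ⟶ Γ}
    (g : Θ ⟶ Ξ) (e : g ≫ f = f'),
    app A B f ⋙ SliceHom.precomp (bump A g e) (bump_up A g e) =
      SliceHom.precomp g e ⋙ app A B f'
  β_precomp : ∀ {Γ Ξ Θ : C} (A : Disp S.D Γ) (B : Disp S.D A.obj) {f : Ξ ⟶ Γ} {f' : Θ ⟶ Γ}
    (g : Θ ⟶ Ξ) (e : g ≫ f = f') (h : SliceHom (S.up f A) B.p),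
    Arrow.mk ((SliceHom.precomp (bump A g e) (bump_up A g e)).map ((β A B f).hom.app h)) =
      Arrow.mk ((β A B f').hom.app
        ((SliceHom.precomp (bump A g e) (bump_up A g e)).obj h))
  η_precomp : ∀ {Γ Ξ Θ : C} (A : Disp S.D Γ) (B : Disp S.D A.obj) {f : Ξ ⟶ Γ} {f' : Θ ⟶ Γ}
    (g : Θ ⟶ Ξ) (e : g ≫ f = f') (k : SliceHom f (Pi A B).p),
    Arrow.mk ((SliceHom.precomp g e).map ((η A B f).hom.app k)) =
      Arrow.mk ((η A B f').hom.app ((SliceHom.precomp g e).obj k))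
  /-- Compatibility with re-indexing along `f`. -/
  lam_re : ∀ {Γ Ξ : C} (A : Disp S.D Γ) (B : Disp S.D A.obj) (f : Ξ ⟶ Γ),
    lam A B f ⋙ S.sec f (Pi A B) ⋙ castSec (Pi_re f A B) =
      S.sec (S.up f A) B ⋙ S.toOne (S.re A f) (S.re B (S.up f A)) ⋙
        lam (S.re A f) (S.re B (S.up f A)) (𝟙 Ξ)
  app_re : ∀ {Γ Ξ : C} (A : Disp S.D Γ) (B : Disp S.D A.obj) (f : Ξ ⟶ Γ),
    app A B f ⋙ S.sec (S.up f A) B ⋙ S.toOne (S.re A f) (S.re B (S.up f A)) =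
      S.sec f (Pi A B) ⋙ castSec (Pi_re f A B) ⋙
        app (S.re A f) (S.re B (S.up f A)) (𝟙 Ξ)
  β_re : ∀ {Γ Ξ : C} (A : Disp S.D Γ) (B : Disp S.D A.obj) (f : Ξ ⟶ Γ)
    (h : SliceHom (S.up f A) B.p),
    Arrow.mk ((S.sec (S.up f A) B ⋙ S.toOne (S.re A f) (S.re B (S.up f A))).map
        ((β A B f).hom.app h)) =
      Arrow.mk ((β (S.re A f) (S.re B (S.up f A)) (𝟙 Ξ)).hom.app
        ((S.sec (S.up f A) B ⋙ S.toOne (S.re A f) (S.re B (S.up f A))).obj h))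
  η_re : ∀ {Γ Ξ : C} (A : Disp S.D Γ) (B : Disp S.D A.obj) (f : Ξ ⟶ Γ)
    (k : SliceHom f (Pi A B).p),
    Arrow.mk ((S.sec f (Pi A B) ⋙ castSec (Pi_re f A B)).map ((η A B f).hom.app k)) =
      Arrow.mk ((η (S.re A f) (S.re B (S.up f A)) (𝟙 Ξ)).hom.app
        ((S.sec f (Pi A B) ⋙ castSec (Pi_re f A B)).obj k))

namespace AxiomaticPi

variable {S : DisplayMap2Category C} (P : AxiomaticPi S)
variable {Γ : C} (A : Disp S.D Γ) (B : Disp S.D A.obj)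

/-- `λ_A^B` on sections of `P_B`. -/
def lamSec : S.Sec B ⥤ S.Sec (P.Pi A B) := S.toOne A B ⋙ P.lam A B (𝟙 Γ)

/-- `app_A^B` on sections of `P_{Π_A^B}`. -/
def appSec : S.Sec (P.Pi A B) ⥤ S.Sec B := P.app A B (𝟙 Γ) ⋙ S.ofOne A B

/-- `ev_A^B = 1;app_A^B(1)`, a section of `P_{B[P_Π•]}`. -/
noncomputable def ev : S.Sec (S.re B (S.up (P.Pi A B).p A)) :=
  (S.sec (S.up (P.Pi A B).p A) B).obj
    ((P.app A B (P.Pi A B).p).obj ⟨𝟙 (P.Pi A B).obj, Category.id_comp _⟩)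

variable {A B}

/-- `ev_A^B[z•]`, for a 1-cell `z : h ⟶ P_Π` of `C / Γ`, as a section of `P_{B[h•]}`, where
`B[h•] = B[P_Π•][z•]`. -/
noncomputable def evAt {Ξ : C} {h : Ξ ⟶ Γ} (z : SliceHom h (P.Pi A B).p) :
    S.Sec (S.re B (S.up h A)) :=
  (castSec (by rw [← S.re_comp, bump_up])).obj
    ((S.secRe (bump A z.map z.w) (S.re B (S.up (P.Pi A B).p A))).obj (P.ev A B))

theorem evAt_up {Ξ : C} {h : Ξ ⟶ Γ} (z : SliceHom h (P.Pi A B).p) :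
    (P.evAt z).map ≫ S.up (S.up h A) B = bump A z.map z.w ≫
      ((P.app A B (P.Pi A B).p).obj ⟨𝟙 (P.Pi A B).obj, Category.id_comp _⟩).map := by
  rw [evAt, castSec_secRe_up (bump_up A z.map z.w)]
  congr 1
  exact sec_obj_up _ _ _

theorem appSec_sec {Ξ : C} {h : Ξ ⟶ Γ} (z : SliceHom h (P.Pi A B).p) :
    (P.appSec (S.re A h) (S.re B (S.up h A))).obj
      ((castSec (P.Pi_re h A B)).obj ((S.sec h (P.Pi A B)).obj z)) = P.evAt z := by
  have h₁ := congrArg (fun F => F.obj z) (P.app_re A B h)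
  have h₂ := congrArg (fun F => F.obj ⟨𝟙 (P.Pi A B).obj, Category.id_comp _⟩)
    (P.app_precomp A B z.map z.w)
  have h₃ : (SliceHom.precomp z.map z.w).obj
      (⟨𝟙 (P.Pi A B).obj, Category.id_comp _⟩ : SliceHom (P.Pi A B).p (P.Pi A B).p) = z :=
    SliceHom.ext (Category.comp_id _)
  simp only [Functor.comp_obj] at h₁ h₂
  rw [h₃] at h₂
  rw [appSec, Functor.comp_obj, ← h₁, ofOne_toOne]
  refine sec_ext ?_
  rw [sec_obj_up, evAt_up, ← h₂]
  rfl

theorem evAt_one : P.evAt (A := A) (B := B) ⟨𝟙 (P.Pi A B).obj, Category.id_comp _⟩ =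
    P.ev A B := by
  refine sec_ext ?_
  rw [evAt_up, ev, sec_obj_up]
  have h : bump A (𝟙 (P.Pi A B).obj) (Category.id_comp (P.Pi A B).p) = 𝟙 _ :=
    SplitDisplay.hom_ext (by rw [bump_up, Category.id_comp])
      (by rw [bump_p, Category.comp_id, Category.id_comp])
  exact (congrArg (· ≫ _) h).trans (Category.id_comp _)

theorem evAt_precomp {Ξ Θ : C} {h : Ξ ⟶ Γ} {h' : Θ ⟶ Γ} (z : SliceHom h (P.Pi A B).p)
    (g : Θ ⟶ Ξ) (e : g ≫ h = h')
    (eD : S.re (S.re B (S.up h A)) (bump A g e) = S.re B (S.up h' A)) :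
    P.evAt ((SliceHom.precomp g e).obj z) =
      (castSec eD).obj ((S.secRe (bump A g e) (S.re B (S.up h A))).obj (P.evAt z)) := by
  refine sec_ext ?_
  rw [castSec_secRe_up (bump_up A g e), evAt_up, evAt_up]
  exact (congrArg (· ≫ _) (bump_comp A g z.map z.w e _)).trans (Category.assoc _ _ _)

theorem Pi_congr {A' : Disp S.D Γ} (e : A' = A) (B' : Disp S.D A'.obj)
    (h : B' = S.re B (eqToHom (congrArg Disp.obj e))) : P.Pi A' B' = P.Pi A B := by
  subst e
  rw [h, eqToHom_refl, S.re_id]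

variable (I : AxiomaticId S)

theorem re_pair {Ξ : C} {u : Ξ ⟶ Γ} {A' : Disp S.D Ξ}
    (e : S.re A u = A') (a b : S.Sec A) :
    S.re (I.Id A') (pair ((castSec e).obj ((S.secRe u A).obj a))
      ((castSec e).obj ((S.secRe u A).obj b))) = S.re (S.re (I.Id A) (pair a b)) u := by
  subst e
  rw [← S.re_comp, ← pair_up₂, S.re_comp, I.Id_re]
  rfl

/-- The display map `Π_{A[h]}^{Id_{B[h•]}[ev[z•];ev[z'•]]}` over `Ξ`, for 1-cells
`z, z' : h ⟶ P_Π` of `C / Γ`. -/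
noncomputable def happlyTy (I : AxiomaticId S) {Ξ : C} {h : Ξ ⟶ Γ}
    (z z' : SliceHom h (P.Pi A B).p) : Disp S.D Ξ :=
  P.Pi (S.re A h) (S.re (I.Id (S.re B (S.up h A))) (pair (P.evAt z) (P.evAt z')))

theorem happlyTy_re {Ξ Θ : C} {h : Ξ ⟶ Γ} {h' : Θ ⟶ Γ} (z z' : SliceHom h (P.Pi A B).p)
    (g : Θ ⟶ Ξ) (e : g ≫ h = h') : S.re (P.happlyTy I z z') g =
      P.happlyTy I ((SliceHom.precomp g e).obj z) ((SliceHom.precomp g e).obj z') := by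
  have eD : S.re (S.re B (S.up h A)) (bump A g e) = S.re B (S.up h' A) := by
    rw [← S.re_comp, bump_up]
  rw [happlyTy, P.Pi_re]
  symm
  refine P.Pi_congr (by rw [← e, S.re_comp]) _ ?_
  rw [P.evAt_precomp z g e eD, P.evAt_precomp z' g e eD, re_pair I, ← S.re_comp _ (S.up g _)]
  rfl

variable (A B)

/-- The object `Γ.Π_A^B.(Π_A^B)▼.Id_{Π_A^B}`. -/
abbrev idObj : C := (I.Id (P.Pi A B)).obj

/-- The display map `Π_{A[P_Π s]}^{Id_{B[(P_Π s)•]}[ev[s•];ev[t•]]}` over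
`Γ.Π_A^B.(Π_A^B)▼.Id_{Π_A^B}`. -/
noncomputable def T : Disp S.D (P.idObj A B I) :=
  P.Pi (S.re A (I.base (P.Pi A B)))
    (S.re (I.Id (S.re B (S.up (I.base (P.Pi A B)) A)))
      (pair (P.evAt (I.s (P.Pi A B))) (P.evAt (I.t (P.Pi A B)))))

/-- The display map `Π_{A[P_Π]}^{Id_{B[P_Π•]}[ev;ev]}` over `Γ.Π_A^B` is `T[r_Π]`. -/
theorem T_r :
    P.Pi (S.re A (P.Pi A B).p)
      (S.re (I.Id (S.re B (S.up (P.Pi A B).p A))) (pair (P.ev A B) (P.ev A B))) =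
    S.re (P.T A B I) (I.r (P.Pi A B)).map := by
  have hs : (SliceHom.precomp (I.r (P.Pi A B)).map (I.r (P.Pi A B)).w).obj (I.s (P.Pi A B)) =
      ⟨𝟙 _, Category.id_comp _⟩ := SliceHom.ext (I.r_src _)
  have ht : (SliceHom.precomp (I.r (P.Pi A B)).map (I.r (P.Pi A B)).w).obj (I.t (P.Pi A B)) =
      ⟨𝟙 _, Category.id_comp _⟩ := SliceHom.ext (I.r_tgt _)
  refine Eq.trans ?_ (P.happlyTy_re I (I.s (P.Pi A B)) (I.t (P.Pi A B))
    (I.r (P.Pi A B)).map (I.r (P.Pi A B)).w).symm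
  rw [hs, ht, happlyTy, evAt_one]

/-- `r_{B[P_Π•]}[ev]`: the section of `P_{Id_{B[P_Π•]}[ev;ev]}` which `(ev;ev)•` takes to
`r_{B[P_Π•]} ev`. -/
noncomputable def rEv : S.Sec (S.re (I.Id (S.re B (S.up (P.Pi A B).p A)))
    (pair (P.ev A B) (P.ev A B))) :=
  (S.sec _ _).obj ⟨(P.ev A B).map ≫ (I.r _).map, by
    refine SplitDisplay.hom_ext ?_ ?_
    · rw [pair_up, Category.assoc, Category.assoc]
      exact (congrArg _ (I.r_tgt _)).trans (Category.comp_id _)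
    · rw [pair_p, Category.assoc, Category.assoc]
      exact (congrArg _ (I.r_src _)).trans (Category.comp_id _)⟩

/-- `happly = J_{abst r_{B[P_Π•]}[ev]}`, a section of `P_T`. -/
noncomputable def happly : S.Sec (P.T A B I) :=
  I.J (P.T A B I) ((castSec (P.T_r A B I)).obj ((P.lamSec _ _).obj (P.rEv A B I)))

/-- The re-indexing `α̃` of `α_Π` along `P_Π s`, with source `s̃` and target `t̃`. -/
noncomputable def αTilde :=
  (S.sec (I.base (P.Pi A B)) (P.Pi A B) ⋙ castSec (P.Pi_re (I.base (P.Pi A B)) A B)).map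
    (I.α (P.Pi A B))

/-- `happ = {app α̃}`, where `app s̃ = ev[s•]` and `app t̃ = ev[t•]`. -/
noncomputable def happ : S.Sec (S.re (I.Id (S.re B (S.up (I.base (P.Pi A B)) A)))
    (pair (P.evAt (I.s (P.Pi A B))) (P.evAt (I.t (P.Pi A B))))) :=
  (castSec (by
    rw [← P.appSec_sec (I.s (P.Pi A B)), ← P.appSec_sec (I.t (P.Pi A B))]; rfl)).obj
    (I.curly ((P.appSec _ _).map (P.αTilde A B I)))

/-- `λ happ`, a section of `P_T`. -/
noncomputable def lamHapp : S.Sec (P.T A B I) := (P.lamSec _ _).obj (P.happ A B I)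

/-- `f••• : Ξ.Π'.Π'▼.Id_{Π'} ⟶ Γ.Π.Π▼.Id_Π`, where `Π = Π_A^B` and
`Π' = Π_{A[f]}^{B[f•]} = Π[f]`. -/
def reIdx {Ξ : C} (f : Ξ ⟶ Γ) : P.idObj (S.re A f) (S.re B (S.up f A)) I ⟶ P.idObj A B I :=
  I.up₃ f (P.Pi_re f A B).symm

end AxiomaticPi

end Slice
end DisplayMap

/-!
Let `q` be a section of a display map `Q` over `Γ.A.A▼.Id_A`, and let `φ : 1 ⟶ r t` be the
contraction of `Id_A`. Then `J_{q[r]}` is the source of the chosen lift of `φ` with target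
`r• q[r] t = q r t`. The 2-cell `q * φ : q ⟶ q r t` also lies over `φ`, so the lift followed by the
inverse of `q * φ` is a vertical 2-cell `J_{q[r]} ⟶ q`.

For `q = λ happ` this is the required 2-cell, because `happly = J_{q[r]}`: the 2-cell `α` restricts
to an identity along `r`, `app` preserves identities, and `{1_a} = r[a]`.

Each ingredient is stable under re-indexing: `φ` because it is determined by its source, its target
and its whiskerings with `s` and `t`, its lift by the stability of the cleavage, and `λ happ`
because `app`, `{-}` and `λ` commute with re-indexing of sections and of vertical 2-cells.
-/

namespace DisplayMap

open SplitDisplay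

section Arrow

variable {T : Type*} [Category T]

theorem arrow_mk_eqToHom {a b : T} (e : a = b) : Arrow.mk (eqToHom e) = Arrow.mk (𝟙 b) := by
  subst e; rfl

/-- The morphism `a ≫ b⁻¹`, for two morphisms of a groupoid with equal targets. -/
noncomputable def compInv [IsGroupoid T] (a b : Arrow T) (e : a.right = b.right) :
    a.left ⟶ b.left :=
  a.hom ≫ eqToHom e ≫ inv b.hom

theorem compInv_congr [IsGroupoid T] {a a' b b' : Arrow T} (ha : a = a') (hb : b = b')
    (e : a.right = b.right) (e' : a'.right = b'.right) :
    Arrow.mk (compInv a b e) = Arrow.mk (compInv a' b' e') := by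
  subst ha hb; rfl

theorem compInv_self [IsGroupoid T] (a : Arrow T) : compInv a a rfl = 𝟙 a.left := by
  simp [compInv]

theorem mapArrow_obj_compInv {T' : Type*} [Category T'] [IsGroupoid T] [IsGroupoid T'] (F : T ⥤ T')
    (a b : Arrow T) (e : a.right = b.right) :
    F.mapArrow.obj (Arrow.mk (compInv a b e)) =
      Arrow.mk (compInv (F.mapArrow.obj a) (F.mapArrow.obj b) (congrArg F.obj e)) := by
  simp [compInv, eqToHom_map, Functor.mapArrow]

end Arrow

/-- Right whiskering of a 2-cell with unspecified source and target, so that the laws of a strict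
bicategory become equations without coherence 2-cells. -/
def arrowWhiskerRight {C : Type u} [Bicategory.{w, v} C] {X Y Z : C} (a : Arrow (X ⟶ Y))
    (f : Y ⟶ Z) : Arrow (X ⟶ Z) :=
  Arrow.mk (a.hom ▷ f)

/-- Left whiskering of a 2-cell with unspecified source and target. -/
def arrowWhiskerLeft {C : Type u} [Bicategory.{w, v} C] {X Y Z : C} (f : X ⟶ Y)
    (a : Arrow (Y ⟶ Z)) : Arrow (X ⟶ Z) :=
  Arrow.mk (f ◁ a.hom)

local infixl:81 " ▷ₐ " => arrowWhiskerRight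
local infixr:81 " ◁ₐ " => arrowWhiskerLeft

section Whiskering

variable {C : Type u} [Bicategory.{w, v} C] {X Y Z W : C}

theorem id_arrowWhiskerRight (x : X ⟶ Y) (f : Y ⟶ Z) :
    Arrow.mk (𝟙 x) ▷ₐ f = Arrow.mk (𝟙 (x ≫ f)) :=
  congrArg Arrow.mk (id_whiskerRight x f)

theorem arrowWhiskerLeft_id (f : X ⟶ Y) (x : Y ⟶ Z) :
    f ◁ₐ Arrow.mk (𝟙 x) = Arrow.mk (𝟙 (f ≫ x)) :=
  congrArg Arrow.mk (whiskerLeft_id f x)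

variable [Bicategory.Strict C]

theorem arrowWhiskerRight_comp (a : Arrow (X ⟶ Y)) (f : Y ⟶ Z) (g : Z ⟶ W) :
    a ▷ₐ (f ≫ g) = (a ▷ₐ f) ▷ₐ g :=
  (arrow_mk_whiskerRight_whiskerRight a.hom f g).symm

theorem comp_arrowWhiskerLeft (f : X ⟶ Y) (g : Y ⟶ Z) (a : Arrow (Z ⟶ W)) :
    (f ≫ g) ◁ₐ a = f ◁ₐ (g ◁ₐ a) :=
  (Arrow.mk_eq_mk_iff _ _).2 ⟨Category.assoc _ _ _, Category.assoc _ _ _, by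
    simp [arrowWhiskerLeft, Strict.associator_eqToIso]⟩

theorem arrowWhisker_assoc (f : X ⟶ Y) (a : Arrow (Y ⟶ Z)) (g : Z ⟶ W) :
    (f ◁ₐ a) ▷ₐ g = f ◁ₐ (a ▷ₐ g) :=
  (Arrow.mk_eq_mk_iff _ _).2 ⟨Category.assoc _ _ _, Category.assoc _ _ _, by
    simp [arrowWhiskerLeft, arrowWhiskerRight, Strict.associator_eqToIso]⟩

theorem arrowWhiskerRight_id (a : Arrow (X ⟶ Y)) : a ▷ₐ 𝟙 Y = a :=
  (Arrow.mk_eq_mk_iff _ _).2 ⟨Category.comp_id _, Category.comp_id _, by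
    simp [Strict.rightUnitor_eqToIso]⟩

theorem id_arrowWhiskerLeft (a : Arrow (X ⟶ Y)) : 𝟙 X ◁ₐ a = a :=
  (Arrow.mk_eq_mk_iff _ _).2 ⟨Category.id_comp _, Category.id_comp _, by
    simp [Strict.leftUnitor_eqToIso]⟩

end Whiskering

variable {C : Type u} [Bicategory.{w, v} C] [Bicategory.Strict C]

namespace SliceHom

variable {X X' Y Γ : C} {h : X ⟶ Γ} {p : Y ⟶ Γ}

theorem arrowWhiskerRight_cell {a b : SliceHom h p} (σ : a ⟶ b) :
    Arrow.mk σ.cell ▷ₐ p = Arrow.mk (𝟙 h) :=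
  (congrArg Arrow.mk σ.vertical).trans <| (arrow_mk_eqToHom _).trans <| by rw [b.w]

theorem vertical_of_arrowWhiskerRight {a b : SliceHom h p} {σ : a.map ⟶ b.map}
    (hσ : Arrow.mk σ ▷ₐ p = Arrow.mk (𝟙 h)) : σ ▷ p = eqToHom (a.w.trans b.w.symm) := by
  obtain ⟨_, _, hσ⟩ := (Arrow.mk_eq_mk_iff _ _).1 hσ
  simpa using hσ

theorem exists_hom_of_arrowWhiskerRight {x : Arrow (X ⟶ Y)} (hx : x ▷ₐ p = Arrow.mk (𝟙 h)) :
    ∃ (a b : SliceHom h p) (σ : a ⟶ b), Arrow.mk σ.cell = x :=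
  let a : SliceHom h p := ⟨x.left, congrArg (·.left) hx⟩
  let b : SliceHom h p := ⟨x.right, congrArg (·.right) hx⟩
  ⟨a, b, ⟨x.hom, vertical_of_arrowWhiskerRight (a := a) (b := b) hx⟩, rfl⟩

theorem arrow_mk_eq_iff {a b a' b' : SliceHom h p} {σ : a ⟶ b} {σ' : a' ⟶ b'} :
    Arrow.mk σ = Arrow.mk σ' ↔ Arrow.mk σ.cell = Arrow.mk σ'.cell := by
  refine ⟨fun e => congrArg (fun x : Arrow (SliceHom h p) => Arrow.mk x.hom.cell) e, fun e => ?_⟩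
  obtain rfl : a = a' := SliceHom.ext (congrArg (·.left) e)
  obtain rfl : b = b' := SliceHom.ext (congrArg (·.right) e)
  rw [hom_ext σ σ' (Arrow.mk_injective _ _ e)]

theorem precomp_comp {X'' : C} (f : X' ⟶ X) {h' : X' ⟶ Γ} (e : f ≫ h = h') (g : X'' ⟶ X')
    {h'' : X'' ⟶ Γ} (e' : g ≫ h' = h'') :
    precomp (p := p) f e ⋙ precomp g e' =
      precomp (g ≫ f) (by rw [Category.assoc, e, e']) :=
  Arrow.functor_ext fun _ _ σ =>
    arrow_mk_eq_iff.2 (comp_arrowWhiskerLeft g f (Arrow.mk σ.cell)).symm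

theorem precomp_id : precomp (p := p) (𝟙 X) (Category.id_comp h) = 𝟭 (SliceHom h p) :=
  Arrow.functor_ext fun _ _ σ => arrow_mk_eq_iff.2 (id_arrowWhiskerLeft (Arrow.mk σ.cell))

theorem precomp_congr {f f' : X' ⟶ X} (hf : f = f') {h' : X' ⟶ Γ} (e : f ≫ h = h') :
    precomp (p := p) f e = precomp f' (hf ▸ e) := by
  subst hf; rfl

end SliceHom

/-- `A'` is the re-indexing `A[g]`. Display maps obtained from `A` by re-indexing along composable
1-cells are only propositionally equal, so re-indexing of display maps, of their sections and of
2-cells between sections is handled through relations instead of transports. -/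
def IsReindexing {S : SplitDisplay C} {Θ Ξ : C} (g : Θ ⟶ Ξ) (A' : Disp S.D Θ) (A : Disp S.D Ξ) :
    Prop :=
  A' = S.re A g

namespace IsReindexing

variable {S : SplitDisplay C} {Λ Θ Ξ Ω : C} {g : Θ ⟶ Ξ} {k : Λ ⟶ Θ}
  {A'' : Disp S.D Λ} {A' : Disp S.D Θ} {A : Disp S.D Ξ}

/-- The 1-cell `g• : Θ.A' ⟶ Ξ.A`. -/
def top (c : IsReindexing g A' A) : A'.obj ⟶ A.obj :=
  Eq.symm c ▸ S.up g A

theorem of_re (g : Θ ⟶ Ξ) (A : Disp S.D Ξ) : IsReindexing g (S.re A g) A := rfl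

theorem congr {g' : Θ ⟶ Ξ} (c : IsReindexing g A' A) (e : g = g') : IsReindexing g' A' A :=
  e ▸ c

theorem top_congr {g' : Θ ⟶ Ξ} (e : g = g') (c : IsReindexing g A' A) (c' : IsReindexing g' A' A) :
    c.top = c'.top := by
  subst e; rfl

theorem top_eq_eqToHom_comp (c : IsReindexing g A' A) :
    c.top = eqToHom (congrArg Disp.obj c) ≫ S.up g A := by
  obtain rfl := c
  exact (Category.id_comp _).symm

theorem top_p (c : IsReindexing g A' A) : c.top ≫ A.p = A'.p ≫ g := by
  obtain rfl := c
  exact up_p g A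

theorem hom_ext (c : IsReindexing g A' A) {x y : Ω ⟶ A'.obj} (h₁ : x ≫ c.top = y ≫ c.top)
    (h₂ : x ≫ A'.p = y ≫ A'.p) : x = y := by
  obtain rfl := c
  exact SplitDisplay.hom_ext h₁ h₂

theorem arrow_ext (c : IsReindexing g A' A) {x y : Arrow (Ω ⟶ A'.obj)}
    (h₁ : x ▷ₐ c.top = y ▷ₐ c.top) (h₂ : x ▷ₐ A'.p = y ▷ₐ A'.p) : x = y := by
  obtain ⟨x₁, x₂, x⟩ := x
  obtain ⟨y₁, y₂, y⟩ := y
  obtain rfl : x₁ = y₁ := c.hom_ext (congrArg (·.left) h₁) (congrArg (·.left) h₂)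
  obtain rfl : x₂ = y₂ := c.hom_ext (congrArg (·.right) h₁) (congrArg (·.right) h₂)
  obtain rfl := c
  exact congrArg Arrow.mk (cell_ext x y (Arrow.mk_injective _ _ h₁) (Arrow.mk_injective _ _ h₂))

theorem comp (c : IsReindexing g A' A) (d : IsReindexing k A'' A') :
    IsReindexing (k ≫ g) A'' A := by
  obtain rfl := c
  obtain rfl := d
  exact (S.re_comp k g A).symm

theorem comp_top (c : IsReindexing g A' A) (d : IsReindexing k A'' A')
    (e : IsReindexing (k ≫ g) A'' A) : d.top ≫ c.top = e.top := by
  obtain rfl := c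
  obtain rfl := d
  rw [e.top_eq_eqToHom_comp, S.up_comp, eqToHom_trans_assoc]
  exact (Category.id_comp _).symm

theorem of_comp {f : Λ ⟶ Ξ} (c : IsReindexing g A' A) (e : IsReindexing f A'' A) (h : k ≫ g = f) :
    IsReindexing k A'' A' := by
  obtain rfl := c
  obtain rfl := e
  subst h
  exact S.re_comp k g A

theorem of_comp_top {f : Λ ⟶ Ξ} (c : IsReindexing g A' A) (e : IsReindexing f A'' A)
    (h : k ≫ g = f) : (c.of_comp e h).top ≫ c.top = e.top :=
  (comp_top c _ (c.comp (c.of_comp e h))).trans (top_congr h _ _)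

theorem top_square {Θ' : C} {g' : Θ' ⟶ Ξ} {k' : Λ ⟶ Θ'} {B' : Disp S.D Θ'}
    (c : IsReindexing g A' A) (d : IsReindexing k A'' A') (c' : IsReindexing g' B' A)
    (d' : IsReindexing k' A'' B') (h : k ≫ g = k' ≫ g') : d.top ≫ c.top = d'.top ≫ c'.top := by
  rw [comp_top c d (c.comp d), comp_top c' d' (c'.comp d')]
  exact top_congr h _ _

theorem wk (c : IsReindexing g A' A) : IsReindexing c.top (S.wk A') (S.wk A) := by
  obtain rfl := c
  exact wk_re g A

theorem wk_top_up (c : IsReindexing g A' A) :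
    c.wk.top ≫ S.up A.p A = S.up A'.p A' ≫ c.top :=
  top_square (of_re A.p A) c.wk c (of_re A'.p A') c.top_p

theorem wk_top_of_re (g : Θ ⟶ Ξ) (A : Disp S.D Ξ) : (of_re g A).wk.top = S.up₂ g A :=
  top_eq_eqToHom_comp _

end IsReindexing

/-- `a'` is the re-indexing `a[g]` of the section `a`. -/
structure IsReindexingSec {S : SplitDisplay C} {Θ Ξ : C} {A' : Disp S.D Θ} {A : Disp S.D Ξ}
    (g : Θ ⟶ Ξ) (a' : S.Sec A') (a : S.Sec A) : Prop where
  disp : IsReindexing g A' A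
  map : a'.map ≫ disp.top = g ≫ a.map

/-- `σ'` is the re-indexing `σ[g]` of the vertical 2-cell `σ`. -/
structure IsReindexingHom {S : SplitDisplay C} {Θ Ξ : C} {A' : Disp S.D Θ} {A : Disp S.D Ξ}
    (g : Θ ⟶ Ξ) {a' b' : S.Sec A'} {a b : S.Sec A} (σ' : a' ⟶ b') (σ : a ⟶ b) : Prop where
  disp : IsReindexing g A' A
  cell : Arrow.mk σ'.cell ▷ₐ disp.top = g ◁ₐ Arrow.mk σ.cell

section Reindexing

variable {S : SplitDisplay C} {Λ Θ Ξ : C} {g : Θ ⟶ Ξ} {A' : Disp S.D Θ} {A : Disp S.D Ξ}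

theorem sec_map_cell_arrowWhiskerRight {f : Θ ⟶ Ξ} {u v : SliceHom f A.p} (σ : u ⟶ v) :
    Arrow.mk ((S.sec f A).map σ).cell ▷ₐ S.up f A = Arrow.mk σ.cell :=
  (congrArg Arrow.mk (sec_map_up σ)).trans (arrow_mk_conj _ _ _)

theorem sec_castSec_map_cell_arrowWhiskerRight {f : Θ ⟶ Ξ} (e : S.re A f = A')
    (c : IsReindexing f A' A) {u v : SliceHom f A.p} (σ : u ⟶ v) :
    Arrow.mk ((S.sec f A ⋙ castSec e).map σ).cell ▷ₐ c.top = Arrow.mk σ.cell := by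
  subst e
  exact sec_map_cell_arrowWhiskerRight σ

theorem isReindexingSec_iff {a' : S.Sec A'} {a : S.Sec A} :
    IsReindexingSec g a' a ↔
      ∃ e : S.re A g = A', (castSec e).obj ((S.secRe g A).obj a) = a' := by
  refine ⟨fun ⟨c, h⟩ => ⟨Eq.symm c, ?_⟩, ?_⟩
  · obtain rfl := c
    exact sec_ext ((secRe_obj_up g A a).trans h.symm)
  · rintro ⟨rfl, rfl⟩
    exact ⟨.of_re g A, secRe_obj_up g A a⟩

theorem isReindexingHom_iff {a' b' : S.Sec A'} {a b : S.Sec A} {σ' : a' ⟶ b'} {σ : a ⟶ b} :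
    IsReindexingHom g σ' σ ↔ ∃ e : S.re A g = A',
      Arrow.mk ((castSec e).map ((S.secRe g A).map σ)) = Arrow.mk σ' := by
  have castSec_cell (e : S.re A g = A') (c : IsReindexing g A' A) :
      Arrow.mk ((castSec e).map ((S.secRe g A).map σ)).cell ▷ₐ c.top = g ◁ₐ Arrow.mk σ.cell :=
    sec_castSec_map_cell_arrowWhiskerRight e c _
  refine ⟨fun ⟨c, h⟩ => ⟨Eq.symm c, SliceHom.arrow_mk_eq_iff.2 (c.arrow_ext ?_ ?_)⟩,
    fun ⟨e, h⟩ => ⟨Eq.symm e, ?_⟩⟩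
  · rw [castSec_cell, h]
  · rw [SliceHom.arrowWhiskerRight_cell, SliceHom.arrowWhiskerRight_cell]
  · exact (congrArg (· ▷ₐ _) (SliceHom.arrow_mk_eq_iff.1 h).symm).trans (castSec_cell e _)

namespace IsReindexingHom

variable {a' b' : S.Sec A'} {a b : S.Sec A} {σ' : a' ⟶ b'} {σ : a ⟶ b}

theorem source (h : IsReindexingHom g σ' σ) : IsReindexingSec g a' a :=
  ⟨h.disp, congrArg (·.left) h.cell⟩

theorem target (h : IsReindexingHom g σ' σ) : IsReindexingSec g b' b :=
  ⟨h.disp, congrArg (·.right) h.cell⟩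

theorem congr {g' : Θ ⟶ Ξ} (h : IsReindexingHom g σ' σ) (e : g = g') : IsReindexingHom g' σ' σ :=
  e ▸ h

theorem of_comp {Λ : C} {k : Λ ⟶ Θ} {f : Λ ⟶ Ξ} {A'' : Disp S.D Λ} {a'' b'' : S.Sec A''}
    {σ'' : a'' ⟶ b''} (c : IsReindexing g A' A) (e : IsReindexing f A'' A) (hf : k ≫ g = f)
    (h : Arrow.mk σ''.cell ▷ₐ e.top = k ◁ₐ (Arrow.mk σ'.cell ▷ₐ c.top)) :
    IsReindexingHom k σ'' σ' := by
  subst hf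
  have d : IsReindexing k A'' A' := c.of_comp e rfl
  refine ⟨d, c.arrow_ext ?_ ?_⟩
  · rw [← arrowWhiskerRight_comp, c.comp_top d e, h, arrowWhisker_assoc]
  · rw [← arrowWhiskerRight_comp, d.top_p, arrowWhiskerRight_comp,
      SliceHom.arrowWhiskerRight_cell, id_arrowWhiskerRight, arrowWhisker_assoc,
      SliceHom.arrowWhiskerRight_cell, arrowWhiskerLeft_id, Category.id_comp, Category.comp_id]

end IsReindexingHom

namespace IsReindexingSec

variable {a' b' : S.Sec A'} {a b : S.Sec A}

theorem castSec {A₁' : Disp S.D Θ} {A₁ : Disp S.D Ξ} (h : IsReindexingSec g a' a) (e' : A' = A₁')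
    (e : A = A₁) :
    IsReindexingSec g ((SplitDisplay.castSec e').obj a') ((SplitDisplay.castSec e).obj a) := by
  subst e e'
  exact h

theorem pair_wk_top (ha : IsReindexingSec g a' a) (hb : IsReindexingSec g b' b) :
    pair a' b' ≫ ha.disp.wk.top = g ≫ pair a b := by
  refine SplitDisplay.hom_ext ?_ ?_
  · rw [Category.assoc, IsReindexing.wk_top_up, ← Category.assoc, pair_up, Category.assoc, pair_up,
      hb.map]
  · rw [Category.assoc, IsReindexing.top_p, ← Category.assoc, pair_p, Category.assoc, pair_p,
      ha.map]

end IsReindexingSec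

end Reindexing

namespace SplitDisplay

theorem toOne_comp_ofOne {S : SplitDisplay C} {Γ : C} (A : Disp S.D Γ) (B : Disp S.D A.obj) :
    S.toOne A B ⋙ S.ofOne A B = 𝟭 (S.Sec B) := by
  refine (SliceHom.precomp_comp _ _ _ _).trans ((SliceHom.precomp_congr ?_ _).trans
    SliceHom.precomp_id)
  simp [S.up_id]

theorem toOne_comp_precomp_bump {S : SplitDisplay C} {Θ Ξ : C} (g : Θ ⟶ Ξ) (A : Disp S.D Ξ)
    (B : Disp S.D A.obj) :
    S.toOne A B ⋙ SliceHom.precomp (bump A g (Category.comp_id g)) (bump_up A g _) =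
      SliceHom.precomp (S.up g A) (Category.comp_id _) :=
  (SliceHom.precomp_comp _ _ _ _).trans (SliceHom.precomp_congr (bump_up A g _) _)

theorem ofOne_comp_precomp_up {S : SplitDisplay C} {Θ Ξ : C} (g : Θ ⟶ Ξ) (A : Disp S.D Ξ)
    (B : Disp S.D A.obj) :
    S.ofOne A B ⋙ SliceHom.precomp (S.up g A) (Category.comp_id _) =
      SliceHom.precomp (bump A g (Category.comp_id g)) (bump_up A g _) := by
  refine (SliceHom.precomp_comp _ _ _ _).trans (SliceHom.precomp_congr ?_ _)
  rw [← bump_up A g (Category.comp_id g), Category.assoc, S.up_id, eqToHom_trans, eqToHom_refl,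
    Category.comp_id]

end SplitDisplay

variable [IsLocallyGroupoid C] {S : DisplayMap2Category C}

namespace AxiomaticId

variable (I : AxiomaticId S)

theorem hom_ext_of_arrowWhiskerLeft_α {Γ X : C} {A : Disp S.D Γ} {x y : X ⟶ (I.Id A).obj}
    (h : x ◁ₐ Arrow.mk (I.α A).cell = y ◁ₐ Arrow.mk (I.α A).cell) : x = y := by
  have hb : y ≫ I.base A = x ≫ I.base A := by
    rw [← (I.s A).w, ← Category.assoc, ← Category.assoc]
    exact congrArg (· ≫ A.p) (congrArg (·.left) h).symm
  exact congrArg SliceHom.map <| (I.isArrowObject A (x ≫ I.base A)).1.injective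
    (a₁ := ⟨x, rfl⟩) (a₂ := ⟨y, hb⟩) (SliceHom.arrow_mk_eq_iff.2 h)

theorem sliceHom_hom_ext {Γ X : C} {A : Disp S.D Γ} {h : X ⟶ Γ} {a b : SliceHom h (I.base A)}
    {σ τ : a ⟶ b} (hs : σ.cell ▷ (I.s A).map = τ.cell ▷ (I.s A).map)
    (ht : σ.cell ▷ (I.t A).map = τ.cell ▷ (I.t A).map) : σ = τ := by
  have := (I.isArrowObject A h).2.2
  exact (SliceHom.arrowComparison (I.α A) h).map_injective <|
    Arrow.hom_ext _ _ (SliceHom.hom_ext _ _ hs) (SliceHom.hom_ext _ _ ht)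

theorem arrow_ext {Γ X : C} {A : Disp S.D Γ} {x y : Arrow (X ⟶ (I.Id A).obj)} {h : X ⟶ Γ}
    (hx : x ▷ₐ I.base A = Arrow.mk (𝟙 h)) (hl : x.left = y.left) (hr : x.right = y.right)
    (hs : x ▷ₐ (I.s A).map = y ▷ₐ (I.s A).map) (ht : x ▷ₐ (I.t A).map = y ▷ₐ (I.t A).map) :
    x = y := by
  have hy : y ▷ₐ I.base A = Arrow.mk (𝟙 h) := by
    rw [← hx, ← (I.s A).w, arrowWhiskerRight_comp, arrowWhiskerRight_comp, hs]
  obtain ⟨a, b, σ, rfl⟩ := SliceHom.exists_hom_of_arrowWhiskerRight hx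
  obtain ⟨a', b', τ, rfl⟩ := SliceHom.exists_hom_of_arrowWhiskerRight hy
  obtain rfl : a = a' := SliceHom.ext hl
  obtain rfl : b = b' := SliceHom.ext hr
  rw [I.sliceHom_hom_ext (Arrow.mk_injective _ _ hs) (Arrow.mk_injective _ _ ht)]

theorem φ_arrowWhiskerRight_s {Γ : C} (A : Disp S.D Γ) :
    Arrow.mk (I.φ A) ▷ₐ (I.s A).map = Arrow.mk (I.α A).cell :=
  (I.φ_exists A).choose_spec.1

theorem φ_arrowWhiskerRight_t {Γ : C} (A : Disp S.D Γ) :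
    Arrow.mk (I.φ A) ▷ₐ (I.t A).map = Arrow.mk (𝟙 (I.t A).map) :=
  (I.φ_exists A).choose_spec.2

theorem φ_arrowWhiskerRight_base {Γ : C} (A : Disp S.D Γ) :
    Arrow.mk (I.φ A) ▷ₐ I.base A = Arrow.mk (𝟙 (I.base A)) := by
  have h := congrArg (· ▷ₐ A.p) (I.φ_arrowWhiskerRight_t A)
  rwa [← arrowWhiskerRight_comp, id_arrowWhiskerRight, (I.t A).w] at h

theorem tilde_arrowWhiskerLeft_α {Γ X : C} {A : Disp S.D Γ} {h : X ⟶ Γ} {a b : SliceHom h A.p}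
    (σ : a ⟶ b) : (I.tilde σ).map ◁ₐ Arrow.mk (I.α A).cell = Arrow.mk σ.cell :=
  I.tilde_cell σ

theorem r_arrowWhiskerLeft_α {Γ : C} (A : Disp S.D Γ) :
    (I.r A).map ◁ₐ Arrow.mk (I.α A).cell = Arrow.mk (𝟙 (𝟙 A.obj)) :=
  I.r_cell A

theorem tilde_id_map {Γ : C} {A : Disp S.D Γ} (a : S.Sec A) :
    (I.tilde (𝟙 a)).map = a.map ≫ (I.r A).map := by
  refine I.hom_ext_of_arrowWhiskerLeft_α ?_
  rw [tilde_arrowWhiskerLeft_α, comp_arrowWhiskerLeft, r_arrowWhiskerLeft_α, arrowWhiskerLeft_id,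
    Category.comp_id]
  rfl

section Reindexing

variable {Θ Ξ : C} {g : Θ ⟶ Ξ} {A' : Disp S.D Θ} {A : Disp S.D Ξ}

theorem isReindexing_Id (c : IsReindexing g A' A) :
    IsReindexing c.wk.top (I.Id A') (I.Id A) := by
  obtain rfl := c
  exact .congr (Eq.symm (I.Id_re g A)) (IsReindexing.wk_top_of_re g A).symm

variable (c : IsReindexing g A' A)

theorem isReindexing_Id_top_s :
    (I.isReindexing_Id c).top ≫ (I.s A).map = (I.s A').map ≫ c.top := by
  change _ ≫ (I.Id A).p ≫ (S.wk A).p = ((I.Id A').p ≫ (S.wk A').p) ≫ _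
  rw [← Category.assoc, IsReindexing.top_p, Category.assoc, IsReindexing.top_p, Category.assoc]

theorem isReindexing_Id_top_t :
    (I.isReindexing_Id c).top ≫ (I.t A).map = (I.t A').map ≫ c.top := by
  change _ ≫ (I.Id A).p ≫ S.up A.p A = ((I.Id A').p ≫ S.up A'.p A') ≫ _
  rw [← Category.assoc, IsReindexing.top_p, Category.assoc, c.wk_top_up, Category.assoc]

theorem isReindexing_Id_top_base : (I.isReindexing_Id c).top ≫ I.base A = I.base A' ≫ g := by
  rw [← (I.s A).w, ← Category.assoc, isReindexing_Id_top_s, Category.assoc, c.top_p,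
    ← Category.assoc, (I.s A').w]

theorem up₃_eq_isReindexing_Id_top : I.up₃ g c = (I.isReindexing_Id c).top := by
  obtain rfl := c
  exact ((IsReindexing.top_congr (IsReindexing.wk_top_of_re g A) (I.isReindexing_Id _)
    (Eq.symm (I.Id_re g A))).trans (IsReindexing.top_eq_eqToHom_comp _)).symm

theorem α_arrowWhiskerRight_top : Arrow.mk (I.α A').cell ▷ₐ c.top =
    (I.isReindexing_Id c).top ◁ₐ Arrow.mk (I.α A).cell := by
  rw [← up₃_eq_isReindexing_Id_top]
  obtain rfl := c
  exact I.α_re g A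

theorem r_comp_isReindexing_Id_top :
    (I.r A').map ≫ (I.isReindexing_Id c).top = c.top ≫ (I.r A).map := by
  refine I.hom_ext_of_arrowWhiskerLeft_α ?_
  rw [comp_arrowWhiskerLeft, ← α_arrowWhiskerRight_top, ← arrowWhisker_assoc,
    r_arrowWhiskerLeft_α, comp_arrowWhiskerLeft, r_arrowWhiskerLeft_α, id_arrowWhiskerRight,
    arrowWhiskerLeft_id, Category.id_comp, Category.comp_id]

theorem φ_arrowWhiskerRight_isReindexing_Id_top :
    Arrow.mk (I.φ A') ▷ₐ (I.isReindexing_Id c).top =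
      (I.isReindexing_Id c).top ◁ₐ Arrow.mk (I.φ A) := by
  refine I.arrow_ext (h := I.base A' ≫ g) ?_ ?_ ?_ ?_ ?_
  · rw [← arrowWhiskerRight_comp, isReindexing_Id_top_base, arrowWhiskerRight_comp,
      φ_arrowWhiskerRight_base, id_arrowWhiskerRight]
  · exact (Category.id_comp _).trans (Category.comp_id _).symm
  · change ((I.t A').map ≫ (I.r A').map) ≫ _ = _ ≫ (I.t A).map ≫ (I.r A).map
    rw [Category.assoc, r_comp_isReindexing_Id_top, ← Category.assoc, ← isReindexing_Id_top_t,
      Category.assoc]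
  · rw [← arrowWhiskerRight_comp, isReindexing_Id_top_s, arrowWhiskerRight_comp,
      φ_arrowWhiskerRight_s, arrowWhisker_assoc, φ_arrowWhiskerRight_s, α_arrowWhiskerRight_top]
  · rw [← arrowWhiskerRight_comp, isReindexing_Id_top_t, arrowWhiskerRight_comp,
      φ_arrowWhiskerRight_t, arrowWhisker_assoc, φ_arrowWhiskerRight_t, id_arrowWhiskerRight,
      arrowWhiskerLeft_id, isReindexing_Id_top_t]

variable {I} {a' b' : S.Sec A'} {a b : S.Sec A} {σ' : a' ⟶ b'} {σ : a ⟶ b}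

theorem isReindexing_Id_pair (ha : IsReindexingSec g a' a) (hb : IsReindexingSec g b' b) :
    IsReindexing g (S.re (I.Id A') (pair a' b')) (S.re (I.Id A) (pair a b)) :=
  .of_comp (.of_re _ _) ((I.isReindexing_Id ha.disp).comp (.of_re _ _))
    (ha.pair_wk_top hb).symm

theorem tilde_comp_isReindexing_Id_top (h : IsReindexingHom g σ' σ) :
    (I.tilde σ').map ≫ (I.isReindexing_Id h.disp).top = g ≫ (I.tilde σ).map := by
  refine I.hom_ext_of_arrowWhiskerLeft_α ?_
  rw [comp_arrowWhiskerLeft, ← α_arrowWhiskerRight_top, ← arrowWhisker_assoc,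
    tilde_arrowWhiskerLeft_α, comp_arrowWhiskerLeft, tilde_arrowWhiskerLeft_α, h.cell]

theorem isReindexingSec_curly (h : IsReindexingHom g σ' σ) :
    IsReindexingSec g (I.curly σ') (I.curly σ) := by
  have c := isReindexing_Id_pair (I := I) h.source h.target
  refine ⟨c, SplitDisplay.hom_ext ?_ ?_⟩
  · have top_up : c.top ≫ S.up (pair a b) (I.Id A) =
        S.up (pair a' b') (I.Id A') ≫ (I.isReindexing_Id h.disp).top :=
      IsReindexing.top_square (.of_re _ _) c _ (.of_re _ _) (h.source.pair_wk_top h.target).symm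
    rw [Category.assoc, top_up, ← Category.assoc, curly, sec_obj_up,
      tilde_comp_isReindexing_Id_top h, Category.assoc, curly, sec_obj_up]
  · rw [Category.assoc, c.top_p, ← Category.assoc, (I.curly σ').w, Category.assoc, (I.curly σ).w,
      Category.id_comp, Category.comp_id]

end Reindexing

end AxiomaticId

namespace AxiomaticPi

variable (P : AxiomaticPi S)

theorem appSec_comp_secRe {Θ Ξ : C} (g : Θ ⟶ Ξ) (A : Disp S.D Ξ) (B : Disp S.D A.obj) :
    P.appSec A B ⋙ S.secRe (S.up g A) B =
      S.secRe g (P.Pi A B) ⋙ castSec (P.Pi_re g A B) ⋙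
        P.appSec (S.re A g) (S.re B (S.up g A)) := by
  calc P.app A B (𝟙 Ξ) ⋙ (S.ofOne A B ⋙ SliceHom.precomp _ _) ⋙ S.sec (S.up g A) B
    _ = (P.app A B (𝟙 Ξ) ⋙ SliceHom.precomp (bump A g (Category.comp_id g)) (bump_up A g _)) ⋙
          S.sec (S.up g A) B := by rw [ofOne_comp_precomp_up]; rfl
    _ = SliceHom.precomp g _ ⋙ P.app A B g ⋙ S.sec (S.up g A) B ⋙ 𝟭 _ := by
          rw [P.app_precomp]; rfl
    _ = SliceHom.precomp g _ ⋙ (P.app A B g ⋙ S.sec (S.up g A) B ⋙ S.toOne _ _) ⋙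
          S.ofOne _ _ := by rw [← toOne_comp_ofOne]; rfl
    _ = _ := by rw [P.app_re]; rfl

theorem lamSec_comp_secRe {Θ Ξ : C} (g : Θ ⟶ Ξ) (A : Disp S.D Ξ) (B : Disp S.D A.obj) :
    P.lamSec A B ⋙ S.secRe g (P.Pi A B) ⋙ castSec (P.Pi_re g A B) =
      S.secRe (S.up g A) B ⋙ P.lamSec (S.re A g) (S.re B (S.up g A)) := by
  calc S.toOne A B ⋙ (P.lam A B (𝟙 Ξ) ⋙ SliceHom.precomp g _) ⋙ S.sec g _ ⋙ castSec _
    _ = (S.toOne A B ⋙ SliceHom.precomp (bump A g (Category.comp_id g)) (bump_up A g _)) ⋙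
          P.lam A B g ⋙ S.sec g _ ⋙ castSec (P.Pi_re g A B) := by rw [P.lam_precomp]; rfl
    _ = SliceHom.precomp (S.up g A) _ ⋙ P.lam A B g ⋙ S.sec g _ ⋙ castSec (P.Pi_re g A B) := by
          rw [toOne_comp_precomp_bump]
    _ = _ := by rw [P.lam_re]; rfl

section Reindexing

variable {Θ Ξ : C} {g : Θ ⟶ Ξ} {A' : Disp S.D Θ} {A : Disp S.D Ξ} {B' : Disp S.D A'.obj}
  {B : Disp S.D A.obj}

theorem isReindexing_Pi (cA : IsReindexing g A' A) (cB : IsReindexing cA.top B' B) :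
    IsReindexing g (P.Pi A' B') (P.Pi A B) := by
  obtain rfl := cA
  obtain rfl := cB
  exact Eq.symm (P.Pi_re g A B)

variable {P}

theorem isReindexingHom_appSec (cA : IsReindexing g A' A) (cB : IsReindexing cA.top B' B)
    {x' y' : S.Sec (P.Pi A' B')} {x y : S.Sec (P.Pi A B)} {σ' : x' ⟶ y'} {σ : x ⟶ y}
    (h : IsReindexingHom g σ' σ) :
    IsReindexingHom cA.top ((P.appSec A' B').map σ') ((P.appSec A B).map σ) := by
  obtain rfl := cA
  obtain rfl := cB
  obtain ⟨e, h⟩ := isReindexingHom_iff.1 h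
  refine isReindexingHom_iff.2 ⟨rfl, ?_⟩
  have app_map_re : Arrow.mk ((S.secRe (S.up g A) B).map ((P.appSec A B).map σ)) =
      Arrow.mk ((P.appSec _ (S.re B (S.up g A))).map
        ((castSec (P.Pi_re g A B)).map ((S.secRe g (P.Pi A B)).map σ))) :=
    congrArg (fun F : S.Sec (P.Pi A B) ⥤ S.Sec (S.re B (S.up g A)) => Arrow.mk (F.map σ))
      (P.appSec_comp_secRe g A B)
  exact app_map_re.trans (congrArg (P.appSec _ _).mapArrow.obj h)

theorem isReindexingSec_lamSec (cA : IsReindexing g A' A) {x' : S.Sec B'} {x : S.Sec B}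
    (h : IsReindexingSec cA.top x' x) :
    IsReindexingSec g ((P.lamSec A' B').obj x') ((P.lamSec A B).obj x) := by
  obtain rfl := cA
  obtain ⟨rfl, rfl⟩ := isReindexingSec_iff.1 h
  exact isReindexingSec_iff.2
    ⟨P.Pi_re g A B, congrArg (fun F => F.obj x) (P.lamSec_comp_secRe g A B)⟩

end Reindexing

variable {Ξ : C} {A : Disp S.D Ξ} {B : Disp S.D A.obj}

theorem lamSec_castSec {B' : Disp S.D A.obj} (e : B = B') (x : S.Sec B) :
    (P.lamSec A B').obj ((castSec e).obj x) =
      (castSec (congrArg (P.Pi A) e)).obj ((P.lamSec A B).obj x) := by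
  subst e
  rfl

variable (I : AxiomaticId S)

/-- The display map `Π_A^{Id_B[app x;app y]}`, the type of pointwise identifications of the
sections `x` and `y` of `Π_A^B`. -/
noncomputable def happTy (x y : S.Sec (P.Pi A B)) : Disp S.D Ξ :=
  P.Pi A (S.re (I.Id B) (pair ((P.appSec A B).obj x) ((P.appSec A B).obj y)))

/-- The section `λ{app σ}` of `Π_A^{Id_B[app x;app y]}`, for a vertical 2-cell `σ : x ⟶ y`; the
target `λ happ` of the homotopy of the theorem is the case `σ = α̃`. -/
noncomputable def lamHappOf {x y : S.Sec (P.Pi A B)} (σ : x ⟶ y) : S.Sec (P.happTy I x y) :=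
  (P.lamSec _ _).obj (I.curly ((P.appSec A B).map σ))

theorem lamHappOf_id (x : S.Sec (P.Pi A B)) :
    P.lamHappOf I (𝟙 x) = (P.lamSec _ _).obj (I.curly (𝟙 ((P.appSec A B).obj x))) := by
  rw [lamHappOf, CategoryTheory.Functor.map_id]

theorem isReindexingSec_lamHappOf {Θ : C} {g : Θ ⟶ Ξ} {A' : Disp S.D Θ} {B' : Disp S.D A'.obj}
    (cA : IsReindexing g A' A) (cB : IsReindexing cA.top B' B)
    {x' y' : S.Sec (P.Pi A' B')} {x y : S.Sec (P.Pi A B)} {σ' : x' ⟶ y'} {σ : x ⟶ y}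
    (h : IsReindexingHom g σ' σ) :
    IsReindexingSec g (P.lamHappOf I σ') (P.lamHappOf I σ) :=
  isReindexingSec_lamSec cA <| AxiomaticId.isReindexingSec_curly <| isReindexingHom_appSec cA cB h

end AxiomaticPi

theorem τ_arrowWhiskerRight_top {Γ Ξ : C} {f : Ξ ⟶ Γ} {A₁ : Disp S.D Γ} {A₂ : Disp S.D A₁.obj}
    {A₃ : Disp S.D A₂.obj} {A₁' : Disp S.D Ξ} {A₂' : Disp S.D A₁'.obj} {A₃' : Disp S.D A₂'.obj}
    (c₁ : IsReindexing f A₁' A₁) (c₂ : IsReindexing c₁.top A₂' A₂) (c₃ : IsReindexing c₂.top A₃' A₃)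
    {Q : Disp S.D A₃.obj} {Q' : Disp S.D A₃'.obj} (cQ : IsReindexing c₃.top Q' Q)
    {Ω Ω' : C} (f' : Ω' ⟶ Ω) {g : Ω ⟶ Q.obj} {h : Ω ⟶ A₃.obj} {g' : Ω' ⟶ Q'.obj}
    {h' : Ω' ⟶ A₃'.obj} (p : h ⟶ g ≫ Q.p) (p' : h' ⟶ g' ≫ Q'.p)
    (hg : g' ≫ cQ.top = f' ≫ g) (hh : h' ≫ c₃.top = f' ≫ h)
    (hp : Arrow.mk p ▷ₐ (A₃.p ≫ A₂.p ≫ A₁.p) = Arrow.mk (𝟙 (h ≫ A₃.p ≫ A₂.p ≫ A₁.p)))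
    (hp' : Arrow.mk p' ▷ₐ (A₃'.p ≫ A₂'.p ≫ A₁'.p) = Arrow.mk (𝟙 (h' ≫ A₃'.p ≫ A₂'.p ≫ A₁'.p)))
    (hpp' : Arrow.mk p' ▷ₐ c₃.top = f' ◁ₐ Arrow.mk p) :
    Arrow.mk (S.τ Q' g' p') ▷ₐ cQ.top = f' ◁ₐ Arrow.mk (S.τ Q g p) := by
  obtain rfl := c₁
  obtain rfl := c₂
  obtain rfl := c₃
  obtain rfl := cQ
  have tele_p {Θ : C} (A₁ : Disp S.D Θ) (A₂ : Disp S.D A₁.obj) (A₃ : Disp S.D A₂.obj) :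
      Tele.p (.cons A₁ (.cons A₂ (.cons A₃ (.nil A₃.obj)))) = A₃.p ≫ A₂.p ≫ A₁.p := by
    simp [Tele.p, Tele.obj]
  refine (S.cleavage_stable f (.cons A₁ (.cons A₂ (.cons A₃ (.nil A₃.obj)))) Q f' g h g' h' p p'
    nofun hg hh ?_ ?_ hpp').2
  · rw [tele_p]
    exact hp
  · exact (arrow_mk_whiskerRight_congr p' (tele_p _ _ _)).trans
      (hp'.trans (congrArg (fun k => Arrow.mk (𝟙 (h' ≫ k))) (tele_p _ _ _).symm))

namespace AxiomaticId

variable (I : AxiomaticId S) {Γ Ξ : C} {A : Disp S.D Γ} {Q : Disp S.D (I.Id A).obj}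

theorem J_source (c : S.Sec (S.re Q (I.r A).map)) :
    (I.t A).map ≫ (I.r A).map = ((I.t A).map ≫ c.map ≫ S.up (I.r A).map Q) ≫ Q.p := by
  rw [Category.assoc, Category.assoc, up_p, ← Category.assoc c.map, c.w, Category.id_comp]

/-- The chosen lift of `φ_A` whose source is `J_c`, with unspecified source and target. -/
noncomputable def φLift (c : S.Sec (S.re Q (I.r A).map)) : Arrow ((I.Id A).obj ⟶ Q.obj) :=
  Arrow.mk (S.τ Q ((I.t A).map ≫ c.map ≫ S.up (I.r A).map Q) (I.φ A ≫ eqToHom (I.J_source c)))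

theorem φLift_arrowWhiskerRight (c : S.Sec (S.re Q (I.r A).map)) :
    I.φLift c ▷ₐ Q.p = Arrow.mk (I.φ A) :=
  (congrArg Arrow.mk (S.τ_p Q _ _)).trans (arrow_mk_conj _ _ _)

theorem φ_arrowWhiskerRight_map_p (q : S.Sec Q) :
    (Arrow.mk (I.φ A) ▷ₐ q.map) ▷ₐ Q.p = Arrow.mk (I.φ A) := by
  rw [← arrowWhiskerRight_comp, q.w, arrowWhiskerRight_id]

theorem φLift_secRe_right (q : S.Sec Q) :
    (I.φLift ((S.secRe (I.r A).map Q).obj q)).right = (Arrow.mk (I.φ A) ▷ₐ q.map).right :=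
  (congrArg ((I.t A).map ≫ ·) (secRe_obj_up _ Q q)).trans (Category.assoc _ _ _).symm

/-- The isomorphism `J_{q[r_A]} ⟶ q`: the lift of `φ_A` followed by the inverse of `q * φ_A`. It is
vertical because both of these 2-cells lie over `φ_A`. -/
noncomputable def jHom (q : S.Sec Q) : I.J Q ((S.secRe (I.r A).map Q).obj q) ⟶ q where
  cell := compInv _ _ (I.φLift_secRe_right q) ≫ eqToHom (Category.id_comp _)
  vertical := SliceHom.vertical_of_arrowWhiskerRight <|
    calc Arrow.mk (compInv _ _ (I.φLift_secRe_right q) ≫ eqToHom _) ▷ₐ Q.p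
      _ = Arrow.mk (compInv _ _ (I.φLift_secRe_right q)) ▷ₐ Q.p :=
        congrArg (· ▷ₐ Q.p) (Arrow.arrow_mk_comp_eqToHom _ _)
      _ = Arrow.mk (compInv (I.φLift _ ▷ₐ Q.p) ((Arrow.mk (I.φ A) ▷ₐ q.map) ▷ₐ Q.p) _) :=
        mapArrow_obj_compInv (postcomp _ Q.p) _ _ _
      _ = Arrow.mk (compInv (Arrow.mk (I.φ A)) (Arrow.mk (I.φ A)) rfl) :=
        compInv_congr (I.φLift_arrowWhiskerRight _) (I.φ_arrowWhiskerRight_map_p q) _ _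
      _ = Arrow.mk (𝟙 (𝟙 (I.Id A).obj)) := congrArg Arrow.mk (compInv_self _)

theorem jHom_cell (q : S.Sec Q) :
    Arrow.mk (I.jHom q).cell = Arrow.mk (compInv _ _ (I.φLift_secRe_right q)) :=
  Arrow.arrow_mk_comp_eqToHom _ _

section Reindexing

variable {f : Ξ ⟶ Γ} {A' : Disp S.D Ξ} (cA : IsReindexing f A' A) {Q' : Disp S.D (I.Id A').obj}
  {q' : S.Sec Q'} {q : S.Sec Q}

theorem φLift_arrowWhiskerRight_top (h : IsReindexingSec (I.isReindexing_Id cA).top q' q) :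
    I.φLift ((S.secRe (I.r A').map Q').obj q') ▷ₐ h.disp.top =
      (I.isReindexing_Id cA).top ◁ₐ I.φLift ((S.secRe (I.r A).map Q).obj q) := by
  refine τ_arrowWhiskerRight_top cA cA.wk (I.isReindexing_Id cA) h.disp _ _ _ ?_ ?_ ?_ ?_ ?_
  · rw [secRe_obj_up, secRe_obj_up, Category.assoc, Category.assoc, h.map,
      ← Category.assoc (I.r A').map, r_comp_isReindexing_Id_top, Category.assoc,
      ← Category.assoc (I.t A').map, ← isReindexing_Id_top_t, Category.assoc]
  · exact (Category.id_comp _).trans (Category.comp_id _).symm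
  · rw [Arrow.arrow_mk_comp_eqToHom, φ_arrowWhiskerRight_base, Category.id_comp]
  · rw [Arrow.arrow_mk_comp_eqToHom, φ_arrowWhiskerRight_base, Category.id_comp]
  · rw [Arrow.arrow_mk_comp_eqToHom, Arrow.arrow_mk_comp_eqToHom,
      φ_arrowWhiskerRight_isReindexing_Id_top]

theorem isReindexingHom_jHom (h : IsReindexingSec (I.isReindexing_Id cA).top q' q) :
    IsReindexingHom (I.isReindexing_Id cA).top (I.jHom q') (I.jHom q) := by
  refine ⟨h.disp, ?_⟩
  have hφ : (Arrow.mk (I.φ A') ▷ₐ q'.map) ▷ₐ h.disp.top =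
      (I.isReindexing_Id cA).top ◁ₐ (Arrow.mk (I.φ A) ▷ₐ q.map) := by
    rw [← arrowWhiskerRight_comp, h.map, arrowWhiskerRight_comp,
      φ_arrowWhiskerRight_isReindexing_Id_top, arrowWhisker_assoc]
  rw [jHom_cell, jHom_cell]
  exact (mapArrow_obj_compInv (postcomp _ h.disp.top) _ _ _).trans <|
    (compInv_congr (I.φLift_arrowWhiskerRight_top cA h) hφ _ _).trans
      (mapArrow_obj_compInv (precomp _ (I.isReindexing_Id cA).top) _ _ _).symm

end Reindexing

end AxiomaticId

namespace AxiomaticPi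

variable (P : AxiomaticPi S) (I : AxiomaticId S) {Γ : C} (A : Disp S.D Γ) (B : Disp S.D A.obj)

theorem happTy_αTilde : P.happTy I
    ((castSec (P.Pi_re _ A B)).obj ((S.sec (I.base (P.Pi A B)) _).obj (I.s (P.Pi A B))))
    ((castSec (P.Pi_re _ A B)).obj ((S.sec (I.base (P.Pi A B)) _).obj (I.t (P.Pi A B)))) =
      P.T A B I := by
  rw [T, ← P.appSec_sec (I.s (P.Pi A B)), ← P.appSec_sec (I.t (P.Pi A B))]
  rfl

theorem lamHapp_eq :
    P.lamHapp A B I = (castSec (P.happTy_αTilde I A B)).obj (P.lamHappOf I (P.αTilde A B I)) :=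
  P.lamSec_castSec _ _

theorem αTilde_arrowWhiskerRight_top (c : IsReindexing (I.base (P.Pi A B))
      (P.Pi (S.re A (I.base (P.Pi A B))) (S.re B (S.up (I.base (P.Pi A B)) A))) (P.Pi A B)) :
    Arrow.mk (P.αTilde A B I).cell ▷ₐ c.top = Arrow.mk (I.α (P.Pi A B)).cell :=
  sec_castSec_map_cell_arrowWhiskerRight _ _ _

theorem rEv_eq : P.rEv A B I = I.curly (𝟙 (P.ev A B)) := by
  rw [rEv, AxiomaticId.curly]
  congr 1
  exact SliceHom.ext (I.tilde_id_map _).symm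

variable {A B} in
theorem isReindexingSec_lamHapp_of_α {Θ : C} {g : Θ ⟶ P.idObj A B I} {h : Θ ⟶ Γ}
    (e : g ≫ I.base (P.Pi A B) = h) {A' : Disp S.D Θ} {B' : Disp S.D A'.obj}
    (cA : IsReindexing h A' A) (cB : IsReindexing cA.top B' B)
    {x y : S.Sec (P.Pi A' B')} {σ : x ⟶ y}
    (hσ : Arrow.mk σ.cell ▷ₐ (P.isReindexing_Pi cA cB).top =
      g ◁ₐ Arrow.mk (I.α (P.Pi A B)).cell) :
    IsReindexingSec g (P.lamHappOf I σ) (P.lamHapp A B I) := by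
  have bA := IsReindexing.of_re (I.base (P.Pi A B)) A
  have bB : IsReindexing bA.top (S.re B (S.up (I.base (P.Pi A B)) A)) B := .of_re _ B
  have bP := P.isReindexing_Pi bA bB
  have σ_over_αTilde : IsReindexingHom g σ (P.αTilde A B I) :=
    .of_comp bP (P.isReindexing_Pi cA cB) e (by rw [P.αTilde_arrowWhiskerRight_top, hσ])
  have gA : IsReindexing g A' (S.re A (I.base (P.Pi A B))) := bA.of_comp cA e
  have gB : IsReindexing gA.top B' (S.re B (S.up (I.base (P.Pi A B)) A)) :=
    bB.of_comp cB (bA.of_comp_top cA e)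
  rw [P.lamHapp_eq]
  exact (P.isReindexingSec_lamHappOf I gA gB σ_over_αTilde).castSec rfl _

theorem isReindexingSec_r_lamHapp :
    IsReindexingSec (I.r (P.Pi A B)).map ((P.lamSec _ _).obj (P.rEv A B I)) (P.lamHapp A B I) := by
  let idPi : SliceHom (P.Pi A B).p (P.Pi A B).p := ⟨𝟙 _, Category.id_comp _⟩
  let F := S.sec (P.Pi A B).p (P.Pi A B) ⋙ castSec (P.Pi_re (P.Pi A B).p A B)
  have app_eq_ev : (P.appSec _ _).obj (F.obj idPi) = P.ev A B :=
    (P.appSec_sec _).trans P.evAt_one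
  have cA : IsReindexing (P.Pi A B).p (S.re A (P.Pi A B).p) A := .of_re _ A
  have cB : IsReindexing cA.top (S.re B (S.up (P.Pi A B).p A)) B := .of_re _ B
  have α_restricts : Arrow.mk (SliceHom.Hom.cell (𝟙 (F.obj idPi))) ▷ₐ
      (P.isReindexing_Pi cA cB).top = (I.r (P.Pi A B)).map ◁ₐ Arrow.mk (I.α (P.Pi A B)).cell := by
    rw [I.r_arrowWhiskerLeft_α, ← CategoryTheory.Functor.map_id]
    exact sec_castSec_map_cell_arrowWhiskerRight _ _ _
  rw [P.rEv_eq, ← app_eq_ev, ← P.lamHappOf_id]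
  exact P.isReindexingSec_lamHapp_of_α I (I.r (P.Pi A B)).w cA cB α_restricts

theorem happly_eq : P.happly A B I =
    I.J (P.T A B I) ((S.secRe (I.r (P.Pi A B)).map (P.T A B I)).obj (P.lamHapp A B I)) := by
  obtain ⟨_, h⟩ :=
    isReindexingSec_iff.1 ((P.isReindexingSec_r_lamHapp I A B).castSec (P.T_r A B I) rfl)
  exact congrArg (I.J (P.T A B I)) h.symm

/-- The 2-cell `θ_A^B : happly ⟶ λ happ`. -/
noncomputable def happlyHom : P.happly A B I ⟶ P.lamHapp A B I :=
  eqToHom (P.happly_eq I A B) ≫ I.jHom (P.lamHapp A B I)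

section Reindexing

variable {Ξ : C} (f : Ξ ⟶ Γ)

theorem isReindexingSec_lamHapp (cP : IsReindexing f (P.Pi (S.re A f) (S.re B (S.up f A)))
      (P.Pi A B)) :
    IsReindexingSec (I.isReindexing_Id cP).top (P.lamHapp (S.re A f) (S.re B (S.up f A)) I)
      (P.lamHapp A B I) := by
  set A' := S.re A f
  set B' := S.re B (S.up f A)
  have cA : IsReindexing f A' A := .of_re f A
  have cB : IsReindexing cA.top B' B := .of_re _ B
  have bA : IsReindexing (I.base (P.Pi A' B')) _ A' := .of_re _ A'
  have bB : IsReindexing bA.top (S.re B' (S.up (I.base (P.Pi A' B')) A')) B' := .of_re _ B'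
  have bP := P.isReindexing_Pi bA bB
  have dB := (cB.comp bB).congr (cA.comp_top bA (cA.comp bA))
  rw [P.lamHapp_eq I A' B']
  refine (P.isReindexingSec_lamHapp_of_α I (I.isReindexing_Id_top_base cP) (cA.comp bA) dB
    ?_).castSec _ rfl
  rw [← cP.comp_top bP, arrowWhiskerRight_comp, P.αTilde_arrowWhiskerRight_top,
    I.α_arrowWhiskerRight_top]

theorem isReindexingHom_happlyHom :
    IsReindexingHom (P.reIdx A B I f) (P.happlyHom I (S.re A f) (S.re B (S.up f A)))
      (P.happlyHom I A B) := by
  have cP : IsReindexing f (P.Pi (S.re A f) (S.re B (S.up f A))) (P.Pi A B) :=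
    Eq.symm (P.Pi_re f A B)
  have h : IsReindexingHom (P.reIdx A B I f) (I.jHom _) (I.jHom (P.lamHapp A B I)) :=
    (I.isReindexingHom_jHom cP (P.isReindexingSec_lamHapp I A B f cP)).congr
      (I.up₃_eq_isReindexing_Id_top cP).symm
  obtain ⟨e, h⟩ := isReindexingHom_iff.1 h
  refine isReindexingHom_iff.2 ⟨e, ?_⟩
  rw [happlyHom, happlyHom, Arrow.arrow_mk_eqToHom_comp, ← h, Functor.map_comp, Functor.map_comp,
    eqToHom_map, eqToHom_map, Arrow.arrow_mk_eqToHom_comp]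

end Reindexing

end AxiomaticPi

end DisplayMap

theorem mainTheorem5 {C : Type u} [Bicategory.{w, v} C] [Bicategory.Strict C] [IsLocallyGroupoid C]
    (S : DisplayMap.DisplayMap2Category C) (I : DisplayMap.AxiomaticId S)
    (P : DisplayMap.AxiomaticPi S) :
    ∃ θ : ∀ {Γ : C} (A : DisplayMap.Disp S.D Γ) (B : DisplayMap.Disp S.D A.obj),
        P.happly A B I ⟶ P.lamHapp A B I,
      ∀ {Γ Ξ : C} (f : Ξ ⟶ Γ) (A : DisplayMap.Disp S.D Γ) (B : DisplayMap.Disp S.D A.obj),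
        ∃ e : S.re (P.T A B I) (P.reIdx A B I f) = P.T (S.re A f) (S.re B (S.up f A)) I,
          Arrow.mk ((DisplayMap.SplitDisplay.castSec e).map
              ((S.secRe (P.reIdx A B I f) (P.T A B I)).map (θ A B))) =
            Arrow.mk (θ (S.re A f) (S.re B (S.up f A))) :=
  ⟨fun A B => P.happlyHom I A B, fun f A B =>
    DisplayMap.isReindexingHom_iff.1 (P.isReindexingHom_happlyHom I A B f)⟩
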